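/- Let $n\ge 1$, $0<\varepsilon<1$ and $1<p<\infty$. There is a constant $C=C(n,p,\varepsilon)>0$ with the following property. Let $0<s<1$, let $\emptyset\neq G\subset\mathbb R^n$ be open, let $L\ge 0$, and let $R:G\to\mathbb R$ be $L$-Lipschitz (that is, $|R(x)-R(y)|\le L|x-y|$ for all $x,y\in G$) with $0\le R(x)\le \operatorname{dist}(x,\partial G)$ for every $x\in G$, where $\operatorname{dist}(x,\partial G)=\infty$ if $G=\mathbb R^n$. For $f\in L^p(G)$ (real-valued) and $x\in G$ put $$M_R(f)(x)=\sup_{0\le r\le R(x)}\frac1{|B(x,r)|}\int_{B(x,r)}|f(y)|\,dy,$$ where the average is read as $|f(x)|$ for $r=0$, and for a measurable function $g$ on $G$ that is finite almost everywhere put $$|g|_{W^{s,p}(G)}=\Bigl(\int_G\int_G\frac{|g(x)-g(y)|^p}{|x-y|^{n+sp}}\,dy\,dx\Bigr)^{1/p}\in[0,\infty].$$ Then, for every $f\in L^p(G)$, the function $M_R(f)$ is measurable and finite almost everywhere on $G$, and $$|M_R(f)|_{W^{s,p}(G)}\le C\,(1+L)^{\varepsilon/p+s}\,|f|_{W^{s,p}(G)}.$$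 -/

import Mathlib

open MeasureTheory Metric Set
open scoped ENNReal NNReal

/-- The mean of `|f|` over the open ball `B(x, r)` of `ℝⁿ`, with the convention that the mean over
`B(x, 0)` is `|f x|`. -/
noncomputable def ballMean {n : ℕ} (f : EuclideanSpace ℝ (Fin n) → ℝ)
    (x : EuclideanSpace ℝ (Fin n)) (r : ℝ) : ℝ≥0∞ :=
  if r = 0 then ‖f x‖ₑ else ⨍⁻ y in ball x r, ‖f y‖ₑ ∂volume

/-- The maximal operator `M_R`: the supremum of the means of `|f|` over the balls `B(x, r)` with
`0 ≤ r ≤ R x`. It takes values in `[0, ∞]`. -/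
noncomputable def maximalR {n : ℕ} (R : EuclideanSpace ℝ (Fin n) → ℝ)
    (f : EuclideanSpace ℝ (Fin n) → ℝ) (x : EuclideanSpace ℝ (Fin n)) : ℝ≥0∞ :=
  ⨆ r ∈ Icc (0 : ℝ) (R x), ballMean f x r

/-- The fractional Sobolev seminorm
`(∫_G ∫_G |f x - f y| ^ p / |x - y| ^ (n + s p) dy dx) ^ (1 / p)`, as an element of `[0, ∞]`
(`‖·‖ₑ` is the absolute value, respectively the Euclidean norm, as an element of `[0, ∞]`). -/
noncomputable def fracSobolevSeminorm {n : ℕ} (s p : ℝ)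
    (G : Set (EuclideanSpace ℝ (Fin n))) (f : EuclideanSpace ℝ (Fin n) → ℝ) : ℝ≥0∞ :=
  (∫⁻ x in G, ∫⁻ y in G, ‖f x - f y‖ₑ ^ p / ‖x - y‖ₑ ^ ((n : ℝ) + s * p)) ^ (1 / p)

/-! Replacing `L` by `max 1 L`, assume `L ≥ 1`. Fix `x ≠ y` in `G`, put `h = |x - y|`, and let `r ≤
R x`. The mean of `|f|` over `B(x, r)` is compared with a mean admissible at `y`; the error consists
of averaged increments of `f`. All balls involved lie in `G`, since `R ≤ dist(·, ∂G)`.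

If `r ≤ h`, compare with `|f y|`. Points of `B(x, r)` are within `2h` of `y`, so the error is at
most `(2h)^β`, `β = n/p + s`, times the Hardy–Littlewood maximal function of the difference quotient
`z ↦ |f y - f z| / |z - y|^β`. Its `p`-th power integrates to a multiple of the seminorm to the
power `p`.

If `h < r ≤ L h`, compare with `|f y|` again; by Jensen the error is at most a constant times the
`p`-th root of the local energy of `f` at `y`, of range `2 L h`.

If `r > L h`, compare with the mean over `B(y, r - L h)`, admissible because `R` is `L`-Lipschitz.
Matching the two balls by dilation moves points by amounts of order `L h`, so the error is an
average of roots of local energies, controlled by their maximal functions at `x` and `y`.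

The maximal theorem (`lintegral_hlMax_rpow_le`) reduces everything to the integral of the local
energy. There Fubini leaves a tail integral of `|v|^(-n-sp-ε)` over `|v| > |z - a| / (2L)`, which
produces `L^(sp+ε)`, hence `L^(s+ε/p)` after the root (`lintegral_lintegral_localEnergy_div_le`).
The extra `ε` keeps the tail constant bounded as `s → 0`. -/

set_option linter.unusedSectionVars false

/-! ### The Hardy–Littlewood maximal theorem for Haar measure on a finite-dimensional normed space.
-/

section HardyLittlewood

variable {E : Type*} [NormedAddCommGroup E] [NormedSpace ℝ E] [FiniteDimensional ℝ E]
  [MeasurableSpace E] [BorelSpace E]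

/-- The centred Hardy–Littlewood maximal function, with the supremum over rational radii. -/
noncomputable def hlMax (μ : Measure E) (g : E → ℝ≥0∞) (x : E) : ℝ≥0∞ :=
  ⨆ (q : ℚ) (_ : 0 < q), ⨍⁻ y in ball x q, g y ∂μ

/-- An open ball is the directed union of its concentric sub-balls of rational radius, and dividing
by the smaller measure only increases the mean. This makes suprema over real radii countable, hence
measurable. -/
theorem setLAverage_ball_le_iSup (μ : Measure E) (g : E → ℝ≥0∞) (x : E) (r : ℝ) :
    ⨍⁻ y in ball x r, g y ∂μ ≤
      ⨆ (q : ℚ) (_ : 0 < q ∧ (q : ℝ) < r), ⨍⁻ y in ball x q, g y ∂μ := by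
  have hU : ball x r = ⋃ q : {q : ℚ // 0 < q ∧ (q : ℝ) < r}, ball x (q : ℚ) := by
    ext y
    simp only [mem_ball, mem_iUnion, Subtype.exists, exists_prop]
    constructor
    · intro hy
      obtain ⟨q, hq1, hq2⟩ := exists_rat_btwn hy
      exact ⟨q, ⟨by exact_mod_cast dist_nonneg.trans_lt hq1, hq2⟩, hq1⟩
    · rintro ⟨q, ⟨_, h2⟩, h3⟩
      exact h3.trans h2
  rw [setLAverage_eq]
  conv_lhs => enter [1]; rw [hU]
  rw [setLIntegral_iUnion_of_directed, ENNReal.iSup_div]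
  · refine iSup_le fun q => ?_
    refine le_trans ?_ (le_iSup₂ (f := fun (q : ℚ) (_ : 0 < q ∧ (q : ℝ) < r) =>
      ⨍⁻ y in ball x q, g y ∂μ) q.1 q.2)
    rw [setLAverage_eq]
    exact ENNReal.div_le_div le_rfl (measure_mono (ball_subset_ball q.2.2.le))
  · exact Monotone.directed_le fun a b hab =>
      ball_subset_ball (by exact_mod_cast hab)

theorem setLAverage_ball_le_hlMax (μ : Measure E) (g : E → ℝ≥0∞) (x : E) (r : ℝ) :
    ⨍⁻ y in ball x r, g y ∂μ ≤ hlMax μ g x :=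
  (setLAverage_ball_le_iSup μ g x r).trans <| iSup_mono fun _ => iSup_le fun h =>
    le_iSup (fun _ => _) h.1

theorem measurable_setLIntegral_ball {A : Type*} [MeasurableSpace A] (μ : Measure E) [SFinite μ]
    {k : A → E → ℝ≥0∞} (hk : Measurable (Function.uncurry k)) {ρ : A × E → ℝ}
    (hρ : Measurable ρ) :
    Measurable fun z : A × E => ∫⁻ y in ball z.2 (ρ z), k z.1 y ∂μ := by
  have hS : MeasurableSet {w : (A × E) × E | dist w.2 w.1.2 < ρ w.1} :=
    measurableSet_lt (by fun_prop) (by fun_prop)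
  have h1 : Measurable fun w : (A × E) × E =>
      {w : (A × E) × E | dist w.2 w.1.2 < ρ w.1}.indicator (fun w => k w.1.1 w.2) w :=
    (hk.comp (by fun_prop : Measurable fun w : (A × E) × E => (w.1.1, w.2))).indicator hS
  have h2 := h1.lintegral_prod_right' (ν := μ)
  convert h2 using 2 with z
  rw [← lintegral_indicator measurableSet_ball]
  rfl

theorem measurable_setLAverage_ball {A : Type*} [MeasurableSpace A] (μ : Measure E) [SFinite μ]
    {k : A → E → ℝ≥0∞} (hk : Measurable (Function.uncurry k)) {ρ : A × E → ℝ}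
    (hρ : Measurable ρ) :
    Measurable fun z : A × E => ⨍⁻ y in ball z.2 (ρ z), k z.1 y ∂μ := by
  simp only [setLAverage_eq]
  refine (measurable_setLIntegral_ball μ hk hρ).div ?_
  have h := measurable_setLIntegral_ball (A := A) μ (k := fun _ _ => 1) measurable_const hρ
  simpa only [setLIntegral_one] using h

theorem measurable_hlMax_uncurry {A : Type*} [MeasurableSpace A] (μ : Measure E) [SFinite μ]
    {k : A → E → ℝ≥0∞} (hk : Measurable (Function.uncurry k)) :
    Measurable fun z : A × E => hlMax μ (k z.1) z.2 := by
  unfold hlMax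
  exact .iSup fun q => .iSup fun _ => measurable_setLAverage_ball μ hk measurable_const

theorem measurable_hlMax (μ : Measure E) [SFinite μ] {g : E → ℝ≥0∞} (hg : Measurable g) :
    Measurable (hlMax μ g) := by
  have hk : Measurable (Function.uncurry fun _ : Unit => g) := hg.comp measurable_snd
  have h' : Measurable fun x : E => ((), x) := by fun_prop
  simpa only [Function.comp_def] using (measurable_hlMax_uncurry μ hk).comp h'

theorem hlMax_le_hlMax_add (μ : Measure E) [IsFiniteMeasureOnCompacts μ]
    {g g' : E → ℝ≥0∞} {c : ℝ≥0∞} (h : ∀ x, g x ≤ g' x + c) (x : E) :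
    hlMax μ g x ≤ hlMax μ g' x + c := by
  refine iSup₂_le fun q hq => ?_
  refine le_trans ?_ (add_le_add_left (setLAverage_ball_le_hlMax μ g' x q) c)
  rw [setLAverage_eq, setLAverage_eq]
  calc (∫⁻ y in ball x q, g y ∂μ) / μ (ball x q)
      ≤ (∫⁻ y in ball x q, (g' y + c) ∂μ) / μ (ball x q) :=
        ENNReal.div_le_div (lintegral_mono fun y => h y) le_rfl
    _ = (∫⁻ y in ball x q, g' y ∂μ) / μ (ball x q) + c * μ (ball x q) / μ (ball x q) := by
        rw [lintegral_add_right _ measurable_const, setLIntegral_const, ENNReal.add_div]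
    _ ≤ _ := by gcongr; exact ENNReal.div_le_of_le_mul le_rfl

variable (μ : Measure E) [μ.IsAddHaarMeasure]

/-- Weak type (1,1) by Vitali covering: disjoint balls with mean above `t` whose fivefold
enlargements cover the level set. -/
theorem mul_measure_lt_hlMax_le (g : E → ℝ≥0∞) (t : ℝ≥0∞) :
    t * μ {x | t < hlMax μ g x} ≤ 5 ^ Module.finrank ℝ E * ∫⁻ x, g x ∂μ := by
  -- Vitali's lemma needs bounded radii; the cap `N` is removed at the end by monotone convergence.
  have key : ∀ N : ℕ, t * μ {x | ∃ q : ℚ, 0 < q ∧ q ≤ N ∧ t < ⨍⁻ y in ball x q, g y ∂μ} ≤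
      5 ^ Module.finrank ℝ E * ∫⁻ x, g x ∂μ := by
    intro N
    set A := {x | ∃ q : ℚ, 0 < q ∧ q ≤ N ∧ t < ⨍⁻ y in ball x q, g y ∂μ} with hA
    have hA' : ∀ x ∈ A, ∃ q : ℚ, 0 < q ∧ q ≤ N ∧ t < ⨍⁻ y in ball x q, g y ∂μ := fun x hx => hx
    choose! q hq0 hqN hqt using hA'
    obtain ⟨u, huA, hdisj, hcov⟩ :=
      Vitali.exists_disjoint_subfamily_covering_enlargement_closedBall A id
        (fun x => (q x : ℝ)) N (fun a ha => by exact_mod_cast hqN a ha) 5 (by norm_num)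
    have hpos : ∀ b ∈ u, (0 : ℝ) < q b := fun b hb => by exact_mod_cast hq0 b (huA hb)
    have hdisj' : u.PairwiseDisjoint fun b => ball b (q b : ℝ) :=
      hdisj.mono fun b => ball_subset_closedBall
    have hcount : u.Countable := hdisj'.countable_of_isOpen (fun _ _ => isOpen_ball)
      fun b hb => nonempty_ball.2 (hpos b hb)
    have hsub : A ⊆ ⋃ b ∈ u, closedBall b (5 * (q b : ℝ)) := by
      intro a ha
      obtain ⟨b, hb, hab⟩ := hcov a ha
      exact mem_biUnion hb (hab (mem_closedBall_self (by exact_mod_cast (hq0 a ha).le)))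
    have := hcount.to_subtype
    calc t * μ A ≤ t * ∑' b : u, μ (closedBall (b : E) (5 * (q b : ℝ))) := by
          gcongr
          exact (measure_mono hsub).trans (measure_biUnion_le μ hcount _)
      _ = ∑' b : u, 5 ^ Module.finrank ℝ E * (t * μ (ball (b : E) (q b : ℝ))) := by
          rw [← ENNReal.tsum_mul_left]
          congr 1 with b
          rw [Measure.addHaar_closedBall _ _ (by linarith [hpos b b.2]),
            Measure.addHaar_ball_of_pos _ _ (hpos b b.2), mul_pow,
            ENNReal.ofReal_mul (by positivity), ENNReal.ofReal_pow (by norm_num)]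
          simp only [ENNReal.ofReal_ofNat]
          ring
      _ ≤ ∑' b : u, 5 ^ Module.finrank ℝ E * ∫⁻ y in ball (b : E) (q b : ℝ), g y ∂μ := by
          refine ENNReal.tsum_le_tsum fun b => ?_
          gcongr
          have h := (hqt b (huA b.2)).le
          rw [setLAverage_eq] at h
          exact ENNReal.mul_le_of_le_div h
      _ = 5 ^ Module.finrank ℝ E * ∫⁻ y in ⋃ b ∈ u, ball (b : E) (q b : ℝ), g y ∂μ := by
          rw [ENNReal.tsum_mul_left, lintegral_biUnion hcount (fun _ _ => measurableSet_ball) hdisj']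
      _ ≤ _ := by gcongr; exact Measure.restrict_le_self
  have hU : {x | t < hlMax μ g x} =
      ⋃ N : ℕ, {x | ∃ q : ℚ, 0 < q ∧ q ≤ N ∧ t < ⨍⁻ y in ball x q, g y ∂μ} := by
    ext x
    simp only [hlMax, lt_iSup_iff, mem_ofPred_eq, mem_iUnion]
    constructor
    · rintro ⟨q, h0, h⟩
      obtain ⟨N, hN⟩ := exists_nat_ge q
      exact ⟨N, q, h0, hN, h⟩
    · rintro ⟨N, q, h0, -, h⟩
      exact ⟨q, h0, h⟩
  rw [hU, Monotone.measure_iUnion, ENNReal.mul_iSup]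
  · exact iSup_le key
  · rintro a b hab x ⟨q, h0, h1, h2⟩
    exact ⟨q, h0, h1.trans (by exact_mod_cast hab), h2⟩

/-- Layer-cake formula for one, possibly infinite, value. It serves with `q = p` for the maximal
function and with `q = p - 1` for the truncated function. -/
theorem lintegral_Ioi_ite_rpow {q : ℝ} (hq : 0 < q) (a : ℝ≥0∞) :
    ∫⁻ t in Ioi (0 : ℝ), (if ENNReal.ofReal t < a then ENNReal.ofReal (t ^ (q - 1)) else 0) =
      a ^ q / ENNReal.ofReal q := by
  have main : ∀ b : ℝ≥0, ∫⁻ t in Ioi (0 : ℝ),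
      (if ENNReal.ofReal t < b then ENNReal.ofReal (t ^ (q - 1)) else 0) =
      (b : ℝ≥0∞) ^ q / ENNReal.ofReal q := by
    intro b
    have h1 : ∫⁻ t in Ioi (0 : ℝ),
        (if ENNReal.ofReal t < b then ENNReal.ofReal (t ^ (q - 1)) else 0) =
        ∫⁻ t in Ioo (0 : ℝ) b, ENNReal.ofReal (t ^ (q - 1)) := by
      rw [← lintegral_indicator measurableSet_Ioi, ← lintegral_indicator measurableSet_Ioo]
      congr 1 with t
      by_cases h0 : 0 < t
      · have : ENNReal.ofReal t < b ↔ t < b := by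
          rw [← ENNReal.ofReal_coe_nnreal, ENNReal.ofReal_lt_ofReal_iff']
          constructor
          · exact fun h => h.1
          · exact fun h => ⟨h, h0.trans h⟩
        simp [indicator, h0, this]
      · simp [indicator, h0]
    have hint : IntervalIntegrable (fun t : ℝ => t ^ (q - 1)) volume 0 b :=
      intervalIntegral.intervalIntegrable_rpow' (by linarith)
    rw [h1, restrict_Ioo_eq_restrict_Ioc, ← ofReal_integral_eq_lintegral_ofReal,
      ← intervalIntegral.integral_of_le b.coe_nonneg, integral_rpow (Or.inl (by linarith)),
      sub_add_cancel, Real.zero_rpow hq.ne', sub_zero, ENNReal.ofReal_div_of_pos hq,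
      ← ENNReal.ofReal_rpow_of_nonneg b.coe_nonneg hq.le, ENNReal.ofReal_coe_nnreal]
    · exact (intervalIntegrable_iff_integrableOn_Ioc_of_le b.2).1 hint
    · filter_upwards [ae_restrict_mem measurableSet_Ioc] with t ht
      exact Real.rpow_nonneg ht.1.le _
  induction a with
  | coe b => exact main b
  | top =>
    rw [ENNReal.top_rpow_of_pos hq, ENNReal.top_div_of_ne_top ENNReal.ofReal_ne_top,
      eq_top_iff]
    have hlim : Filter.Tendsto (fun n : ℕ => (n : ℝ≥0∞) ^ q / ENNReal.ofReal q) Filter.atTop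
        (nhds ∞) := by
      have h := ENNReal.Tendsto.div_const (b := ENNReal.ofReal q) (((ENNReal.continuous_rpow_const
        (y := q)).tendsto ∞).comp ENNReal.tendsto_nat_nhds_top) (by right; simpa using hq)
      rwa [ENNReal.top_rpow_of_pos hq, ENNReal.top_div_of_ne_top ENNReal.ofReal_ne_top] at h
    refine le_of_tendsto' hlim fun n => ?_
    have h := main n
    rw [ENNReal.coe_natCast] at h
    rw [← h]
    refine lintegral_mono fun t => ?_
    dsimp only
    split_ifs with h1 h2
    · exact le_rfl
    · exact absurd ENNReal.ofReal_lt_top h2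
    · exact zero_le
    · exact le_rfl

/-- Marcinkiewicz interpolation: at each height the weak-type bound is applied only to the large
part of `g`, and the heights are integrated by Tonelli. -/
theorem lintegral_hlMax_rpow_le {p : ℝ} (hp : 1 < p) :
    ∃ C : ℝ≥0, ∀ g : E → ℝ≥0∞, Measurable g →
      ∫⁻ x, hlMax μ g x ^ p ∂μ ≤ C * ∫⁻ x, g x ^ p ∂μ := by
  have hp1 : 0 < p - 1 := sub_pos.2 hp
  have hp0 : 0 < p := zero_lt_one.trans hp
  set K : ℝ≥0∞ := 2 * 5 ^ Module.finrank ℝ E with hK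
  have hKtop : K ≠ ∞ := by finiteness
  have hC : ENNReal.ofReal p * K * (2 ^ (p - 1) / ENNReal.ofReal (p - 1)) ≠ ∞ := by
    refine ENNReal.mul_ne_top (by finiteness) (ENNReal.div_ne_top (by finiteness) ?_)
    simpa using hp
  refine ⟨_, fun g hg => le_of_le_of_eq ?_ (by rw [ENNReal.coe_toNNReal hC])⟩
  have hMg := measurable_hlMax μ hg
  -- One factor `t` is spent on the weak-type estimate; the remaining `t ^ (p - 2)` is integrable at
  -- `0` because `p > 1`.
  have hpow : ∀ t : ℝ, 0 < t → ENNReal.ofReal (t ^ (p - 1)) =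
      ENNReal.ofReal (t ^ (p - 1 - 1)) * ENNReal.ofReal t := by
    intro t ht
    rw [← ENNReal.ofReal_mul (by positivity)]
    congr 1
    rw [← Real.rpow_add_one ht.ne']
    ring_nf
  have hweak : ∀ t : ℝ, ENNReal.ofReal t * μ {x | ENNReal.ofReal t < hlMax μ g x} ≤
      K * ∫⁻ x, (if ENNReal.ofReal t < 2 * g x then g x else 0) ∂μ := by
    intro t
    set τ := ENNReal.ofReal t
    -- The discarded part of `g` is at most `τ / 2`, so it raises the maximal function by at most `τ
    -- / 2`.
    set g' : E → ℝ≥0∞ := fun x => if τ < 2 * g x then g x else 0 with hg'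
    have hle : ∀ x, g x ≤ g' x + τ / 2 := by
      intro x
      by_cases h : τ < 2 * g x
      · simp [hg', h]
      · simp only [hg', h, if_false, zero_add]
        rw [ENNReal.le_div_iff_mul_le (by simp) (by simp), mul_comm]
        exact not_lt.1 h
    have hsub : {x | τ < hlMax μ g x} ⊆ {x | τ / 2 < hlMax μ g' x} := by
      intro x hx
      by_contra hcon
      have h1 := hlMax_le_hlMax_add μ hle x
      have h2 : hlMax μ g x ≤ τ / 2 + τ / 2 := h1.trans (add_le_add_left (not_lt.1 hcon) _)
      rw [ENNReal.add_halves] at h2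
      exact absurd hx (not_lt.2 h2)
    calc τ * μ {x | τ < hlMax μ g x} ≤ τ * μ {x | τ / 2 < hlMax μ g' x} := by gcongr
      _ = 2 * (τ / 2 * μ {x | τ / 2 < hlMax μ g' x}) := by
          rw [← mul_assoc, ENNReal.mul_div_cancel (by simp) (by simp)]
      _ ≤ 2 * (5 ^ Module.finrank ℝ E * ∫⁻ x, g' x ∂μ) := by
          exact mul_le_mul' le_rfl (mul_measure_lt_hlMax_le μ g' _)
      _ = _ := by rw [hK, mul_assoc]
  have hpp : ∀ x, hlMax μ g x ^ p = ENNReal.ofReal p * ∫⁻ t in Ioi (0 : ℝ),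
      (if ENNReal.ofReal t < hlMax μ g x then ENNReal.ofReal (t ^ (p - 1)) else 0) := by
    intro x
    rw [lintegral_Ioi_ite_rpow hp0, ENNReal.mul_div_cancel (by simpa using hp0) (by simp)]
  have hmeas1 : Measurable fun w : E × ℝ =>
      (if ENNReal.ofReal w.2 < hlMax μ g w.1 then ENNReal.ofReal (w.2 ^ (p - 1)) else 0) :=
    Measurable.ite (measurableSet_lt (by fun_prop) (hMg.comp measurable_fst))
      (by fun_prop) measurable_const
  have hmeas2 : Measurable fun w : ℝ × E =>
      ENNReal.ofReal (w.1 ^ (p - 1 - 1)) *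
        (if ENNReal.ofReal w.1 < 2 * g w.2 then g w.2 else 0) :=
    Measurable.mul (by fun_prop) (Measurable.ite (measurableSet_lt (by fun_prop) (by fun_prop))
      (by fun_prop) measurable_const)
  calc ∫⁻ x, hlMax μ g x ^ p ∂μ
      = ENNReal.ofReal p * ∫⁻ x, (∫⁻ t in Ioi (0 : ℝ),
        (if ENNReal.ofReal t < hlMax μ g x then ENNReal.ofReal (t ^ (p - 1)) else 0)) ∂μ := by
        rw [← lintegral_const_mul' _ _ (by simp)]
        exact lintegral_congr hpp
    _ = ENNReal.ofReal p * ∫⁻ t in Ioi (0 : ℝ), ENNReal.ofReal (t ^ (p - 1)) *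
        μ {x | ENNReal.ofReal t < hlMax μ g x} := by
        rw [lintegral_lintegral_swap hmeas1.aemeasurable]
        congr 1
        refine lintegral_congr fun t => ?_
        rw [← lintegral_indicator_const (measurableSet_lt measurable_const hMg)]
        simp only [indicator, mem_ofPred_eq]
    _ ≤ ENNReal.ofReal p * ∫⁻ t in Ioi (0 : ℝ), K * ∫⁻ x, ENNReal.ofReal (t ^ (p - 1 - 1)) *
        (if ENNReal.ofReal t < 2 * g x then g x else 0) ∂μ := by
        gcongr ENNReal.ofReal p * ?_
        refine setLIntegral_mono' measurableSet_Ioi fun t ht => ?_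
        rw [hpow t ht, lintegral_const_mul' _ _ (by simp), mul_assoc, mul_left_comm K]
        exact mul_le_mul' le_rfl (hweak t)
    _ = ENNReal.ofReal p * K * ∫⁻ x, g x * (∫⁻ t in Ioi (0 : ℝ),
        (if ENNReal.ofReal t < 2 * g x then ENNReal.ofReal (t ^ (p - 1 - 1)) else 0)) ∂μ := by
        rw [lintegral_const_mul' _ _ hKtop, lintegral_lintegral_swap hmeas2.aemeasurable, ← mul_assoc]
        congr 1
        refine lintegral_congr fun x => ?_
        rw [← lintegral_const_mul]
        · refine lintegral_congr fun t => ?_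
          split_ifs <;> simp [mul_comm]
        · exact Measurable.ite (measurableSet_lt (by fun_prop) measurable_const)
            (by fun_prop) measurable_const
    _ = ENNReal.ofReal p * K * ∫⁻ x, (2 ^ (p - 1) / ENNReal.ofReal (p - 1)) * g x ^ p ∂μ := by
        congr 1
        refine lintegral_congr fun x => ?_
        rw [lintegral_Ioi_ite_rpow hp1, ENNReal.mul_rpow_of_nonneg _ _ hp1.le,
          div_eq_mul_inv, div_eq_mul_inv]
        have : g x ^ p = g x * g x ^ (p - 1) := by
          conv_rhs => enter [1]; rw [← ENNReal.rpow_one (g x)]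
          rw [← ENNReal.rpow_add_of_nonneg _ _ zero_le_one hp1.le]
          ring_nf
        rw [this]; ring
    _ = _ := by rw [lintegral_const_mul _ (by fun_prop), ← mul_assoc]

end HardyLittlewood

/-! ### Comparison of means of `|f|` over balls around two points. -/

section PointwiseBounds

theorem setLAverage_le_rpow_setLAverage_rpow {α : Type*} [MeasurableSpace α] {μ : Measure α} {s : Set α}
    (h0 : μ s ≠ 0) (hs : μ s ≠ ∞) {p : ℝ} (hp : 1 ≤ p) {g : α → ℝ≥0∞} (hg : Measurable g) :
    ⨍⁻ x in s, g x ∂μ ≤ (⨍⁻ x in s, g x ^ p ∂μ) ^ (1 / p) := by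
  have : IsFiniteMeasure (μ.restrict s) := ⟨by simpa using hs.lt_top⟩
  have : NeZero (μ.restrict s) := ⟨by simpa using h0⟩
  have h := eLpNorm'_le_eLpNorm'_of_exponent_le (f := g) zero_lt_one hp
    (((μ.restrict s) univ)⁻¹ • μ.restrict s) hg.aestronglyMeasurable
  simpa [eLpNorm', laverage] using h

variable {E : Type*} [NormedAddCommGroup E] [NormedSpace ℝ E] [FiniteDimensional ℝ E]
  [MeasurableSpace E] [BorelSpace E] (μ : Measure E) [μ.IsAddHaarMeasure]

/-- Means over balls with different centres and radii become integrals over one ball and can be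
compared point by point. -/
theorem setLAverage_ball_eq_unit (g : E → ℝ≥0∞) (x : E) {r : ℝ} (hr : 0 < r) :
    ⨍⁻ y in ball x r, g y ∂μ = ⨍⁻ z in ball (0 : E) 1, g (x + r • z) ∂μ := by
  let φ : E ≃ₜ E := (Homeomorph.smulOfNeZero r hr.ne').trans (Homeomorph.addLeft x)
  have hφ : ∀ z, φ z = x + r • z := fun z => rfl
  have hpre : φ ⁻¹' ball x r = ball 0 1 := by
    ext z
    simp only [mem_preimage, hφ, mem_ball, dist_self_add_left, dist_zero_right, norm_smul,
      Real.norm_of_nonneg hr.le]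
    exact mul_lt_iff_lt_one_right hr
  have hmap : Measure.map φ μ = ENNReal.ofReal ((r ^ Module.finrank ℝ E)⁻¹) • μ := by
    have h1 : (φ : E → E) = (fun y => x + y) ∘ (fun y => r • y) := rfl
    rw [h1, ← Measure.map_map (by fun_prop) (by fun_prop), Measure.map_addHaar_smul μ hr.ne',
      Measure.map_smul, map_add_left_eq_self, abs_of_nonneg (by positivity)]
  have h := φ.measurableEmbedding.lintegral_map (μ := μ.restrict (ball 0 1)) g
  rw [← hpre, ← φ.measurableEmbedding.restrict_map, hmap, Measure.restrict_smul,
    lintegral_smul_measure, hpre] at h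
  have hV : μ (ball x r) = ENNReal.ofReal (r ^ Module.finrank ℝ E) * μ (ball 0 1) :=
    Measure.addHaar_ball_of_pos μ x hr
  rw [setLAverage_eq, setLAverage_eq, hV]
  simp only [hφ] at h
  rw [← h, smul_eq_mul, ENNReal.ofReal_inv_of_pos (by positivity), div_eq_mul_inv, div_eq_mul_inv,
    ENNReal.mul_inv (Or.inr measure_ball_lt_top.ne) (Or.inl ENNReal.ofReal_ne_top)]
  ring

theorem setLAverage_ball_le_add_of_forall {x : E} {r : ℝ} (hr : 0 < r) {g k : E → ℝ≥0∞}
    {c : ℝ≥0∞} (h : ∀ z ∈ ball x r, g z ≤ c + k z) :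
    ⨍⁻ z in ball x r, g z ∂μ ≤ c + ⨍⁻ z in ball x r, k z ∂μ := by
  have h0 : μ (ball x r) ≠ 0 := (measure_ball_pos μ x hr).ne'
  have h1 : μ (ball x r) ≠ ∞ := measure_ball_lt_top.ne
  simp only [setLAverage_eq]
  calc (∫⁻ z in ball x r, g z ∂μ) / μ (ball x r)
      ≤ (∫⁻ z in ball x r, (c + k z) ∂μ) / μ (ball x r) :=
        ENNReal.div_le_div (setLIntegral_mono' measurableSet_ball h) le_rfl
    _ = _ := by
        rw [lintegral_add_left measurable_const, setLIntegral_const, ENNReal.add_div,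
          ENNReal.mul_div_cancel_right h0 h1]

/-- The energy at `a` of a two-point function `D` over the ball of radius `2 L ‖v‖`. -/
noncomputable def localEnergy (D : E → E → ℝ≥0∞) (L ε p : ℝ) (v a : E) : ℝ≥0∞ :=
  ∫⁻ z, (if ‖z - a‖ < 2 * L * ‖v‖ then
    D a z ^ p / (‖z - a‖ₑ ^ ((Module.finrank ℝ E : ℝ) - ε) * ‖v‖ₑ ^ ε) else 0) ∂μ

/-- After Jensen, `B(x₀, r)` lies within `2 r ≤ 2 L ‖v‖` of `a`. There `‖z - a‖` and `‖v‖` are both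
at most `2 r`, so the weight `‖z - a‖^(d-ε) ‖v‖^ε` is at most `(2 r)^d`, which is comparable to the
volume of the ball. -/
theorem setLAverage_ball_le_localEnergy {D : E → E → ℝ≥0∞} (hDd : ∀ a, D a a = 0)
    {a : E} (hD : Measurable (D a)) {L ε p : ℝ} (hp : 1 ≤ p) (hε : 0 < ε)
    (hεd : ε ≤ Module.finrank ℝ E) {v x₀ : E} {r : ℝ} (hv : 0 < ‖v‖) (hvr : ‖v‖ ≤ r)
    (hrL : r ≤ L * ‖v‖) (hsub : ball x₀ r ⊆ ball a (2 * r)) :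
    ⨍⁻ c in ball x₀ r, D a c ∂μ ≤
      (2 ^ Module.finrank ℝ E / μ (ball 0 1)) ^ (1 / p) * localEnergy μ D L ε p v a ^ (1 / p) := by
  set d := Module.finrank ℝ E with hd
  have hr : 0 < r := hv.trans_le hvr
  have hp0 : 0 < p := by linarith
  refine (setLAverage_le_rpow_setLAverage_rpow (measure_ball_pos μ x₀ hr).ne'
    measure_ball_lt_top.ne hp hD).trans ?_
  rw [← ENNReal.mul_rpow_of_nonneg _ _ (by positivity)]
  refine ENNReal.rpow_le_rpow ?_ (by positivity)
  rw [setLAverage_eq, Measure.addHaar_ball_of_pos μ x₀ hr, localEnergy]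
  have hpt : ∀ z ∈ ball x₀ r, D a z ^ p ≤ ENNReal.ofReal (r ^ d) * (2 ^ d *
      (if ‖z - a‖ < 2 * L * ‖v‖ then
        D a z ^ p / (‖z - a‖ₑ ^ ((d : ℝ) - ε) * ‖v‖ₑ ^ ε) else 0)) := by
    intro z hz
    have hza : ‖z - a‖ < 2 * r := by simpa [dist_eq_norm] using hsub hz
    rw [if_pos (by nlinarith)]
    rcases eq_or_ne z a with rfl | hne
    · simp [hDd, ENNReal.zero_rpow_of_pos hp0]
    have hw : 0 < ‖z - a‖ := norm_pos_iff.2 (sub_ne_zero.2 hne)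
    set den := ‖z - a‖ₑ ^ ((d : ℝ) - ε) * ‖v‖ₑ ^ ε with hden
    have hdenR : den = ENNReal.ofReal (‖z - a‖ ^ ((d : ℝ) - ε) * ‖v‖ ^ ε) := by
      rw [hden, ENNReal.ofReal_mul (by positivity), ← ENNReal.ofReal_rpow_of_pos hw,
        ← ENNReal.ofReal_rpow_of_pos hv, ofReal_norm, ofReal_norm]
    have hle : den ≤ ENNReal.ofReal (r ^ d) * 2 ^ d := by
      have h2 : (2 : ℝ≥0∞) ^ d = ENNReal.ofReal (2 ^ d) := by
        rw [ENNReal.ofReal_pow (by norm_num)]; simp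
      rw [hdenR, h2, ← ENNReal.ofReal_mul (by positivity)]
      refine ENNReal.ofReal_le_ofReal ?_
      calc ‖z - a‖ ^ ((d : ℝ) - ε) * ‖v‖ ^ ε ≤ (2 * r) ^ ((d : ℝ) - ε) * (2 * r) ^ ε := by
            gcongr
            linarith
        _ = (2 * r) ^ d := by
            rw [← Real.rpow_add (by positivity), sub_add_cancel, Real.rpow_natCast]
        _ = r ^ d * 2 ^ d := by rw [mul_pow, mul_comm]
    have hd0 : den ≠ 0 := by rw [hdenR]; simpa using by positivity
    have hdt : den ≠ ∞ := by rw [hdenR]; exact ENNReal.ofReal_ne_top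
    calc D a z ^ p = den * (D a z ^ p / den) := (ENNReal.mul_div_cancel hd0 hdt).symm
      _ ≤ (ENNReal.ofReal (r ^ d) * 2 ^ d) * (D a z ^ p / den) := by gcongr
      _ = _ := by rw [mul_assoc]
  have hr0 : ENNReal.ofReal (r ^ d) ≠ 0 := by simpa using by positivity
  have hμ0 : μ (ball (0 : E) 1) ≠ 0 := (measure_ball_pos μ 0 one_pos).ne'
  calc (∫⁻ z in ball x₀ r, D a z ^ p ∂μ) / (ENNReal.ofReal (r ^ d) * μ (ball 0 1))
      ≤ (∫⁻ z in ball x₀ r, ENNReal.ofReal (r ^ d) * (2 ^ d *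
      (if ‖z - a‖ < 2 * L * ‖v‖ then
        D a z ^ p / (‖z - a‖ₑ ^ ((d : ℝ) - ε) * ‖v‖ₑ ^ ε) else 0)) ∂μ) /
          (ENNReal.ofReal (r ^ d) * μ (ball 0 1)) :=
        ENNReal.div_le_div (setLIntegral_mono' measurableSet_ball hpt) le_rfl
    _ ≤ (ENNReal.ofReal (r ^ d) * (2 ^ d * ∫⁻ z, (if ‖z - a‖ < 2 * L * ‖v‖ then
        D a z ^ p / (‖z - a‖ₑ ^ ((d : ℝ) - ε) * ‖v‖ₑ ^ ε) else 0) ∂μ)) /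
          (ENNReal.ofReal (r ^ d) * μ (ball 0 1)) := by
        rw [lintegral_const_mul' _ _ (by simp), lintegral_const_mul' _ _ (by simp)]
        gcongr
        exact Measure.restrict_le_self
    _ = _ := by
        rw [ENNReal.mul_div_mul_left _ _ hr0 (by simp), div_eq_mul_inv, div_eq_mul_inv]
        ring

/-- The increment `|f x - f y|`, cut off to pairs of points of `G`. -/
noncomputable def localDiff (G : Set E) (f : E → ℝ) (x y : E) : ℝ≥0∞ :=
  open Classical in if x ∈ G ∧ y ∈ G then ‖f x - f y‖ₑ else 0

variable {μ} {G : Set E} {f : E → ℝ}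

theorem localDiff_of_mem {x y : E} (hx : x ∈ G) (hy : y ∈ G) :
    localDiff G f x y = ‖f x - f y‖ₑ := if_pos ⟨hx, hy⟩

@[simp] theorem localDiff_self (x : E) : localDiff G f x x = 0 := by
  simp [localDiff]

theorem localDiff_comm (x y : E) : localDiff G f x y = localDiff G f y x := by
  by_cases hx : x ∈ G <;> by_cases hy : y ∈ G <;> simp [localDiff, hx, hy, enorm_sub_rev (f x)]

theorem enorm_le_add_localDiff {x y : E} (hx : x ∈ G) (hy : y ∈ G) :
    ‖f x‖ₑ ≤ ‖f y‖ₑ + localDiff G f y x := by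
  rw [localDiff_comm, localDiff_of_mem hx hy]
  calc ‖f x‖ₑ = ‖f y + (f x - f y)‖ₑ := by rw [add_sub_cancel]
    _ ≤ _ := enorm_add_le _ _

theorem measurable_localDiff (hG : MeasurableSet G) (hf : Measurable f) :
    Measurable (Function.uncurry (localDiff G f)) := by
  unfold localDiff
  refine Measurable.ite ?_ ?_ measurable_const
  · exact (hG.preimage measurable_fst).inter (hG.preimage measurable_snd)
  · exact ((hf.comp measurable_fst).sub (hf.comp measurable_snd)).enorm

/-- Small radii: every `z` in the ball satisfies `‖z - y‖ ≤ 2 ‖x - y‖`, so the increment is at most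
`(2 ‖x - y‖)^β` times the difference quotient based at `y`. -/
theorem setLAverage_le_of_radius_le_dist {x y : E} {r : ℝ} (hr : 0 < r) (hrh : r ≤ ‖x - y‖)
    (hsub : ball x r ⊆ G) (hy : y ∈ G) {β : ℝ} (hβ : 0 ≤ β) :
    ⨍⁻ z in ball x r, ‖f z‖ₑ ∂μ ≤ ‖f y‖ₑ +
      (2 * ‖x - y‖ₑ) ^ β * hlMax μ (fun z => localDiff G f y z / ‖z - y‖ₑ ^ β) x := by
  refine (setLAverage_ball_le_add_of_forall μ hr (k := fun z => (2 * ‖x - y‖ₑ) ^ β *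
    (localDiff G f y z / ‖z - y‖ₑ ^ β)) (c := ‖f y‖ₑ) ?_).trans ?_
  · intro z hz
    refine (enorm_le_add_localDiff (hsub hz) hy).trans (add_le_add le_rfl ?_)
    rcases eq_or_ne z y with rfl | hne
    · simp
    have h0 : ‖z - y‖ₑ ≠ 0 := by simpa [sub_eq_zero] using hne
    have h1 : ‖z - y‖ₑ ≤ 2 * ‖x - y‖ₑ := by
      rw [← ofReal_norm, ← ofReal_norm, ← ENNReal.ofReal_ofNat 2,
        ← ENNReal.ofReal_mul (by norm_num)]
      refine ENNReal.ofReal_le_ofReal ?_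
      have h2 : ‖z - x‖ < r := by simpa [dist_eq_norm] using hz
      have h3 := norm_add_le (z - x) (x - y)
      rw [sub_add_sub_cancel] at h3
      linarith
    calc localDiff G f y z = ‖z - y‖ₑ ^ β * (localDiff G f y z / ‖z - y‖ₑ ^ β) := by
          rw [ENNReal.mul_div_cancel]
          · simp [ENNReal.rpow_eq_zero_iff, h0]
          · exact ENNReal.rpow_ne_top_of_nonneg hβ (by simp)
      _ ≤ _ := by gcongr
  · gcongr
    rw [setLAverage_eq, lintegral_const_mul', mul_div_assoc, ← setLAverage_eq]
    · gcongr
      exact setLAverage_ball_le_hlMax _ _ _ _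
    · exact ENNReal.rpow_ne_top_of_nonneg hβ (by finiteness)

theorem setLAverage_le_of_radius_le_mul_dist (hG : MeasurableSet G) (hf : Measurable f)
    {x y : E} {r : ℝ} {L ε p : ℝ} (hp : 1 ≤ p) (hε : 0 < ε) (hεd : ε ≤ Module.finrank ℝ E)
    (hxy : 0 < ‖x - y‖) (hr : ‖x - y‖ ≤ r) (hrL : r ≤ L * ‖x - y‖)
    (hsub : ball x r ⊆ G) (hy : y ∈ G) :
    ⨍⁻ z in ball x r, ‖f z‖ₑ ∂μ ≤ ‖f y‖ₑ + (2 ^ Module.finrank ℝ E / μ (ball 0 1)) ^ (1 / p) *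
      localEnergy μ (localDiff G f) L ε p (x - y) y ^ (1 / p) := by
  refine (setLAverage_ball_le_add_of_forall μ (hxy.trans_le hr) (k := localDiff G f y)
    (c := ‖f y‖ₑ) fun z hz => enorm_le_add_localDiff (hsub hz) hy).trans ?_
  gcongr
  refine setLAverage_ball_le_localEnergy μ localDiff_self
    (measurable_localDiff hG hf).of_uncurry_left hp hε hεd hxy hr hrL ?_
  refine ball_subset_ball' ?_
  rw [dist_eq_norm]
  linarith

/-- Both `a` and `b` are compared with a variable `c` in a ball close to both; averaging over `c`
turns the two increments into local energies. -/
theorem enorm_le_of_ball_subset (hG : MeasurableSet G) (hf : Measurable f)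
    {a b m v : E} {r : ℝ} {L ε p : ℝ} (hp : 1 ≤ p) (hε : 0 < ε) (hεd : ε ≤ Module.finrank ℝ E)
    (hv : 0 < ‖v‖) (hr : ‖v‖ ≤ r) (hrL : r ≤ L * ‖v‖)
    (hsub : ball m r ⊆ G) (ha : a ∈ G) (hb : b ∈ G) (hma : dist m a ≤ r) (hmb : dist m b ≤ r) :
    ‖f a‖ₑ ≤ ‖f b‖ₑ + (2 ^ Module.finrank ℝ E / μ (ball 0 1)) ^ (1 / p) *
      (localEnergy μ (localDiff G f) L ε p v a ^ (1 / p) +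
        localEnergy μ (localDiff G f) L ε p v b ^ (1 / p)) := by
  have hr0 := hv.trans_le hr
  have hD : ∀ a, Measurable (localDiff G f a) := fun a =>
    (measurable_localDiff hG hf).of_uncurry_left
  have h1 : ‖f a‖ₑ = ⨍⁻ c in ball m r, ‖f a‖ₑ ∂μ :=
    (setLAverage_const (measure_ball_pos μ m hr0).ne' measure_ball_lt_top.ne _).symm
  have h2 : ∀ c ∈ ball m r, ‖f a‖ₑ ≤ ‖f b‖ₑ + (localDiff G f a c + localDiff G f b c) := by
    intro c hc
    calc ‖f a‖ₑ ≤ ‖f c‖ₑ + localDiff G f c a := enorm_le_add_localDiff ha (hsub hc)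
      _ ≤ ‖f b‖ₑ + localDiff G f b c + localDiff G f c a := by
        gcongr; exact enorm_le_add_localDiff (hsub hc) hb
      _ = _ := by rw [localDiff_comm c a]; ring
  rw [h1]
  refine (setLAverage_ball_le_add_of_forall μ hr0 h2).trans ?_
  gcongr
  have h3 : ∀ a, dist m a ≤ r → ball m r ⊆ ball a (2 * r) := fun a h =>
    ball_subset_ball' (by linarith)
  rw [setLAverage_eq, lintegral_add_left (hD a), ENNReal.add_div, mul_add,
    ← setLAverage_eq, ← setLAverage_eq]
  gcongr
  · exact setLAverage_ball_le_localEnergy μ localDiff_self (hD a) hp hε hεd hv hr hrL (h3 a hma)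
  · exact setLAverage_ball_le_localEnergy μ localDiff_self (hD b) hp hε hεd hv hr hrL (h3 b hmb)

theorem measurable_localEnergy_kernel {D : E → E → ℝ≥0∞} (hD : Measurable (Function.uncurry D))
    (L ε p : ℝ) : Measurable fun w : (E × E) × E =>
      (if ‖w.2 - w.1.2‖ < 2 * L * ‖w.1.1‖ then D w.1.2 w.2 ^ p /
        (‖w.2 - w.1.2‖ₑ ^ ((Module.finrank ℝ E : ℝ) - ε) * ‖w.1.1‖ₑ ^ ε) else 0) := by
  have h : Measurable fun w : (E × E) × E => D w.1.2 w.2 :=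
    hD.comp (by fun_prop : Measurable fun w : (E × E) × E => (w.1.2, w.2))
  exact Measurable.ite (measurableSet_lt (by fun_prop) (by fun_prop)) (by fun_prop)
    measurable_const

theorem measurable_localEnergy {D : E → E → ℝ≥0∞} (hD : Measurable (Function.uncurry D))
    (L ε p : ℝ) : Measurable (Function.uncurry (localEnergy μ D L ε p)) :=
  (measurable_localEnergy_kernel hD L ε p).lintegral_prod_right'

/-- Large radii: `x + r z` is paired with `y + (r - σ) z` for `z` in the unit ball, where `σ = L ‖x
- y‖`. The resulting energies are averaged over `B(x, r)` and `B(y, r - σ)`, hence bounded by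
maximal functions. -/
theorem setLAverage_le_of_mul_dist_lt_radius (hG : MeasurableSet G) (hf : Measurable f)
    {x y : E} {r : ℝ} {L ε p : ℝ} (hL : 1 ≤ L) (hp : 1 ≤ p) (hε : 0 < ε)
    (hεd : ε ≤ Module.finrank ℝ E) (hxy : 0 < ‖x - y‖) (hr : L * ‖x - y‖ < r)
    (hsub : ball x r ⊆ G) (hsub' : ball y (r - L * ‖x - y‖) ⊆ G) :
    ⨍⁻ z in ball x r, ‖f z‖ₑ ∂μ ≤ (⨍⁻ z in ball y (r - L * ‖x - y‖), ‖f z‖ₑ ∂μ) +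
      (2 ^ Module.finrank ℝ E / μ (ball 0 1)) ^ (1 / p) *
      (hlMax μ (fun a => localEnergy μ (localDiff G f) L ε p (x - y) a ^ (1 / p)) x +
        hlMax μ (fun a => localEnergy μ (localDiff G f) L ε p (x - y) a ^ (1 / p)) y) := by
  set σ := L * ‖x - y‖ with hσ
  have hσ0 : 0 < σ := by positivity
  have hσh : ‖x - y‖ ≤ σ := le_mul_of_one_le_left hxy.le hL
  have hr0 : 0 < r := by linarith
  have hr' : 0 < r - σ := by linarith
  set Q := fun a => localEnergy μ (localDiff G f) L ε p (x - y) a ^ (1 / p) with hQ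
  set c := (2 ^ Module.finrank ℝ E / μ (ball (0 : E) 1)) ^ (1 / p) with hc
  have hQm : Measurable Q :=
    ((measurable_localEnergy (measurable_localDiff hG hf) L ε p).of_uncurry_left).pow_const _
  have hpt : ∀ z ∈ ball (0 : E) 1, ‖f (x + r • z)‖ₑ ≤ ‖f (y + (r - σ) • z)‖ₑ +
      c * (Q (x + r • z) + Q (y + (r - σ) • z)) := by
    intro z hz
    have hz1 : ‖z‖ < 1 := by simpa using hz
    -- The centre `m` lies within `σ` of `x + r z`, within `‖x - y‖ ≤ σ` of `y + (r - σ) z`, and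
    -- `B(m, σ) ⊆ B(x, r)`.
    refine enorm_le_of_ball_subset (m := x + (r - σ) • z) hG hf hp hε hεd hxy hσh le_rfl
      ((ball_subset_ball' ?_).trans hsub) (hsub ?_) (hsub' ?_) ?_ ?_
    · rw [dist_self_add_left, norm_smul, Real.norm_of_nonneg hr'.le]
      nlinarith
    · rw [mem_ball, dist_self_add_left, norm_smul, Real.norm_of_nonneg hr0.le]
      nlinarith
    · rw [mem_ball, dist_self_add_left, norm_smul, Real.norm_of_nonneg hr'.le]
      nlinarith
    · rw [dist_add_left, dist_eq_norm, ← sub_smul, norm_smul, Real.norm_eq_abs,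
        show r - σ - r = -σ by ring, abs_neg, abs_of_pos hσ0]
      nlinarith
    · rw [dist_add_right, dist_eq_norm]
      exact hσh
  have h0 : μ (ball (0 : E) 1) ≠ 0 := (measure_ball_pos μ 0 one_pos).ne'
  have hQx : ⨍⁻ z in ball (0 : E) 1, Q (x + r • z) ∂μ ≤ hlMax μ Q x := by
    rw [← setLAverage_ball_eq_unit μ Q x hr0]
    exact setLAverage_ball_le_hlMax μ Q x _
  have hQy : ⨍⁻ z in ball (0 : E) 1, Q (y + (r - σ) • z) ∂μ ≤ hlMax μ Q y := by
    rw [← setLAverage_ball_eq_unit μ Q y hr']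
    exact setLAverage_ball_le_hlMax μ Q y _
  refine le_trans ?_ (add_le_add le_rfl (mul_le_mul' le_rfl (add_le_add hQx hQy)))
  rw [setLAverage_ball_eq_unit μ _ x hr0, setLAverage_ball_eq_unit μ _ y hr']
  have hcT : c ≠ ∞ := ENNReal.rpow_ne_top_of_nonneg (by positivity)
    (ENNReal.div_ne_top (by finiteness) h0)
  simp only [setLAverage_eq]
  rw [← ENNReal.add_div, ← mul_div_assoc, ← ENNReal.add_div,
    ← lintegral_add_left (by fun_prop), ← lintegral_const_mul' _ _ hcT,
    ← lintegral_add_left (by fun_prop)]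
  exact ENNReal.div_le_div (setLIntegral_mono' measurableSet_ball hpt) le_rfl

end PointwiseBounds

/-! ### Integration of the pointwise bounds against the fractional kernel. -/

section EnergyIntegrals

theorem ENNReal.rpow_add_le_two_rpow_mul {p : ℝ} (hp : 1 ≤ p) (a b : ℝ≥0∞) :
    (a + b) ^ p ≤ 2 ^ p * (a ^ p + b ^ p) := by
  refine (ENNReal.rpow_add_le_mul_rpow_add_rpow a b hp).trans ?_
  gcongr
  · norm_num
  · linarith

theorem ENNReal.rpow_add_add_le_four_rpow_mul {p : ℝ} (hp : 1 ≤ p) (a b c : ℝ≥0∞) :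
    (a + b + c) ^ p ≤ 4 ^ p * (a ^ p + b ^ p + c ^ p) := by
  have h4 : (4 : ℝ≥0∞) ^ p = 2 ^ p * 2 ^ p := by
    rw [← ENNReal.mul_rpow_of_nonneg _ _ (by linarith)]; norm_num
  have h1 : (1 : ℝ≥0∞) ≤ 2 ^ p := ENNReal.one_le_rpow (by norm_num) (by linarith)
  calc (a + b + c) ^ p ≤ 2 ^ p * ((a + b) ^ p + 1 * c ^ p) := by
        rw [one_mul]; exact ENNReal.rpow_add_le_two_rpow_mul hp _ _
    _ ≤ 2 ^ p * (2 ^ p * (a ^ p + b ^ p) + 2 ^ p * c ^ p) := by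
        gcongr; exact ENNReal.rpow_add_le_two_rpow_mul hp _ _
    _ = _ := by rw [h4]; ring

variable {E : Type*} [NormedAddCommGroup E] [NormedSpace ℝ E] [FiniteDimensional ℝ E]
  [MeasurableSpace E] [BorelSpace E] (μ : Measure E) [μ.IsAddHaarMeasure]

theorem lintegral_eq_mul_lintegral_comp_smul (g : E → ℝ≥0∞) {r : ℝ} (hr : 0 < r) :
    ∫⁻ v, g v ∂μ = ENNReal.ofReal (r ^ Module.finrank ℝ E) * ∫⁻ u, g (r • u) ∂μ := by
  have h := (Homeomorph.smulOfNeZero (α := E) r hr.ne').measurableEmbedding.lintegral_map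
    (μ := μ) g
  have hc : ((Homeomorph.smulOfNeZero (α := E) r hr.ne') : E → E) = (r • ·) := rfl
  rw [hc, Measure.map_addHaar_smul μ hr.ne', lintegral_smul_measure,
    abs_of_nonneg (by positivity), smul_eq_mul] at h
  rw [← h, ← mul_assoc, ← ENNReal.ofReal_mul (by positivity), mul_inv_cancel₀ (by positivity),
    ENNReal.ofReal_one, one_mul]

/-- Scaling by `ρ` gives the power of `ρ`. On `‖u‖ > 1` the exponent `α` may be lowered to `ε`, so
one constant serves all `α ≥ ε`. -/
theorem exists_lintegral_tail_le {ε : ℝ} (hε : 0 < ε) :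
    ∃ C : ℝ≥0, ∀ α : ℝ, ε ≤ α → ∀ ρ : ℝ, 0 < ρ →
      ∫⁻ v : E, (if ρ < ‖v‖ then (‖v‖ₑ ^ (Module.finrank ℝ E + α))⁻¹ else 0) ∂μ ≤
        C * (ENNReal.ofReal ρ ^ α)⁻¹ := by
  set d := Module.finrank ℝ E with hd
  have hfin := finite_integral_one_add_norm (μ := μ) (E := E) (r := d + ε) (by linarith)
  set K := ∫⁻ u : E, ENNReal.ofReal ((1 + ‖u‖) ^ (-(d + ε))) ∂μ with hK
  have hC : ENNReal.ofReal (2 ^ (d + ε)) * K ≠ ∞ := ENNReal.mul_ne_top (by simp) hfin.ne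
  refine ⟨(ENNReal.ofReal (2 ^ (d + ε)) * K).toNNReal, fun α hα ρ hρ => ?_⟩
  rw [ENNReal.coe_toNNReal hC, lintegral_eq_mul_lintegral_comp_smul μ _ hρ]
  have hpt : ∀ u : E, (if ρ < ‖ρ • u‖ then (‖ρ • u‖ₑ ^ (d + α))⁻¹ else 0) ≤
      ENNReal.ofReal (ρ ^ (-(d + α))) * (ENNReal.ofReal (2 ^ (d + ε)) *
        ENNReal.ofReal ((1 + ‖u‖) ^ (-(d + ε)))) := by
    intro u
    split_ifs with h
    · rw [norm_smul, Real.norm_of_nonneg hρ.le] at h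
      have hu : 1 < ‖u‖ := by
        by_contra hcon
        nlinarith
      have hu0 : 0 < ‖u‖ := by linarith
      have hru : 0 < ‖ρ • u‖ := by rw [norm_smul, Real.norm_of_nonneg hρ.le]; positivity
      rw [← ofReal_norm, ENNReal.ofReal_rpow_of_pos hru,
        ← ENNReal.ofReal_inv_of_pos (by positivity), ← ENNReal.ofReal_mul (by positivity),
        ← ENNReal.ofReal_mul (by positivity)]
      refine ENNReal.ofReal_le_ofReal ?_
      rw [← Real.rpow_neg (norm_nonneg _), norm_smul, Real.norm_of_nonneg hρ.le,
        Real.mul_rpow hρ.le hu0.le]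
      gcongr
      calc ‖u‖ ^ (-(d + α)) ≤ ‖u‖ ^ (-(d + ε)) :=
            Real.rpow_le_rpow_of_exponent_le hu.le (by linarith)
        _ = 2 ^ (d + ε) * (2 * ‖u‖) ^ (-(d + ε)) := by
            rw [Real.mul_rpow (by norm_num) hu0.le, ← mul_assoc, ← Real.rpow_add (by norm_num),
              add_neg_cancel, Real.rpow_zero, one_mul]
        _ ≤ _ := by
            gcongr 2 ^ (d + ε) * ?_
            refine Real.rpow_le_rpow_of_nonpos (by positivity) (by linarith) ?_
            have : (0 : ℝ) ≤ d := Nat.cast_nonneg d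
            linarith
    · exact zero_le
  calc _ ≤ ENNReal.ofReal (ρ ^ d) * ∫⁻ u : E, ENNReal.ofReal (ρ ^ (-(d + α))) *
        (ENNReal.ofReal (2 ^ (d + ε)) * ENNReal.ofReal ((1 + ‖u‖) ^ (-(d + ε)))) ∂μ := by
        gcongr; exact hpt _
    _ = ENNReal.ofReal (ρ ^ d) * ENNReal.ofReal (ρ ^ (-(d + α))) *
        (ENNReal.ofReal (2 ^ (d + ε)) * K) := by
        rw [lintegral_const_mul' _ _ (by simp), lintegral_const_mul' _ _ (by simp), mul_assoc]
    _ = _ := by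
        rw [ENNReal.ofReal_rpow_of_pos hρ, ← ENNReal.ofReal_inv_of_pos (by positivity),
          ← ENNReal.ofReal_mul (by positivity), ← Real.rpow_natCast, ← Real.rpow_add hρ,
          ← Real.rpow_neg hρ.le, mul_comm]
        ring_nf

variable {μ}

theorem lintegral_lintegral_sub_right {F : E × E → ℝ≥0∞} (hF : Measurable F) :
    ∫⁻ x, ∫⁻ y, F (x - y, y) ∂μ ∂μ = ∫⁻ v, ∫⁻ a, F (v, a) ∂μ ∂μ := by
  rw [lintegral_lintegral_swap (f := fun x y => F (x - y, y))
    (hF.comp (by fun_prop : Measurable fun z : E × E => (z.1 - z.2, z.2))).aemeasurable,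
    lintegral_lintegral_swap (f := fun v a => F (v, a)) hF.aemeasurable]
  exact lintegral_congr fun y => lintegral_sub_right_eq_self (fun v => F (v, y)) y

theorem lintegral_lintegral_sub_left {F : E × E → ℝ≥0∞} (hF : Measurable F) :
    ∫⁻ x, ∫⁻ y, F (x - y, x) ∂μ ∂μ = ∫⁻ v, ∫⁻ a, F (v, a) ∂μ ∂μ := by
  rw [lintegral_lintegral_swap (f := fun v a => F (v, a)) hF.aemeasurable]
  exact lintegral_congr fun x => lintegral_sub_left_eq_self (fun v => F (v, x)) x

/-- The maximal theorem is applied for each fixed `v`; the weight does not depend on `a`. -/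
theorem lintegral_lintegral_hlMax_rpow_div_le {C : ℝ≥0∞} {p : ℝ}
    (hC : ∀ g : E → ℝ≥0∞, Measurable g →
      ∫⁻ x, hlMax μ g x ^ p ∂μ ≤ C * ∫⁻ x, g x ^ p ∂μ)
    {k : E → E → ℝ≥0∞} (hk : Measurable (Function.uncurry k)) {w : E → ℝ≥0∞}
    (hw : Measurable w) :
    ∫⁻ v, ∫⁻ a, hlMax μ (k v) a ^ p / w v ∂μ ∂μ ≤ C * ∫⁻ v, ∫⁻ a, k v a ^ p / w v ∂μ ∂μ := by
  have hkv : ∀ v, Measurable (k v) := fun v => hk.of_uncurry_left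
  have hm : Measurable fun v => ∫⁻ a, k v a ^ p / w v ∂μ :=
    Measurable.lintegral_prod_right' (f := fun z : E × E => k z.1 z.2 ^ p / w z.1)
      ((hk.pow_const p).div (hw.comp measurable_fst))
  rw [← lintegral_const_mul _ hm]
  refine lintegral_mono fun v => ?_
  simp only [div_eq_mul_inv]
  rw [lintegral_mul_const _ ((measurable_hlMax μ (hkv v)).pow_const p),
    lintegral_mul_const _ ((hkv v).pow_const p), ← mul_assoc]
  gcongr
  exact hC _ (hkv v)

/-- Integrating in `v` first leaves a tail over `‖v‖ > ‖z - a‖ / (2 L)` with exponent `α = τ + ε`.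
Its value restores the kernel `‖a - z‖^(-(d+τ))` and yields the factor `(2 L)^(τ+ε)`. -/
theorem lintegral_lintegral_localEnergy_div_le {ε : ℝ} {C : ℝ≥0∞}
    (hC : ∀ α : ℝ, ε ≤ α → ∀ ρ : ℝ, 0 < ρ →
      ∫⁻ v : E, (if ρ < ‖v‖ then (‖v‖ₑ ^ (Module.finrank ℝ E + α))⁻¹ else 0) ∂μ ≤
        C * (ENNReal.ofReal ρ ^ α)⁻¹)
    (hε : 0 < ε) {D : E → E → ℝ≥0∞} (hDd : ∀ a, D a a = 0) (hD : Measurable (Function.uncurry D))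
    {p L τ : ℝ} (hp : 0 < p) (hτ : 0 ≤ τ) (hL : 0 < L) :
    ∫⁻ v, ∫⁻ a, localEnergy μ D L ε p v a / ‖v‖ₑ ^ (Module.finrank ℝ E + τ) ∂μ ∂μ ≤
      C * ENNReal.ofReal (2 * L) ^ (τ + ε) *
        ∫⁻ a, ∫⁻ z, D a z ^ p / ‖a - z‖ₑ ^ (Module.finrank ℝ E + τ) ∂μ ∂μ := by
  set d := Module.finrank ℝ E with hd
  have hmK := measurable_localEnergy_kernel hD L ε p
  set K : (E × E) × E → ℝ≥0∞ := fun w =>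
      (if ‖w.2 - w.1.2‖ < 2 * L * ‖w.1.1‖ then D w.1.2 w.2 ^ p /
        (‖w.2 - w.1.2‖ₑ ^ ((d : ℝ) - ε) * ‖w.1.1‖ₑ ^ ε) else 0) with hK
  have hmF : Measurable fun w : (E × E) × E => K w / ‖w.1.1‖ₑ ^ (d + τ) := by fun_prop
  have hinner : ∀ a z, ∫⁻ v, K ((v, a), z) / ‖v‖ₑ ^ (d + τ) ∂μ ≤
      C * ENNReal.ofReal (2 * L) ^ (τ + ε) * (D a z ^ p / ‖a - z‖ₑ ^ (d + τ)) := by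
    intro a z
    rcases eq_or_ne z a with rfl | hne
    · simp [hK, hDd, ENNReal.zero_rpow_of_pos hp]
    have hw : 0 < ‖z - a‖ := norm_pos_iff.2 (sub_ne_zero.2 hne)
    have hwe0 : ‖z - a‖ₑ ≠ 0 := by simpa [sub_eq_zero] using hne
    have hpt : ∀ v : E, K ((v, a), z) / ‖v‖ₑ ^ (d + τ) =
        D a z ^ p / ‖z - a‖ₑ ^ ((d : ℝ) - ε) *
        (if ‖z - a‖ / (2 * L) < ‖v‖ then (‖v‖ₑ ^ (d + (τ + ε)))⁻¹ else 0) := by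
      intro v
      have hiff : ‖z - a‖ / (2 * L) < ‖v‖ ↔ ‖z - a‖ < 2 * L * ‖v‖ := by
        rw [div_lt_iff₀' (by positivity)]
      simp only [hK, hiff]
      split_ifs with h
      · have hv : 0 < ‖v‖ := by
          by_contra hcon
          nlinarith
        have hve : ‖v‖ₑ ≠ 0 := by simpa using norm_pos_iff.1 hv
        have h1 : ‖v‖ₑ ^ (d + (τ + ε)) = ‖v‖ₑ ^ ε * ‖v‖ₑ ^ (d + τ) := by
          rw [← ENNReal.rpow_add _ _ hve (by simp)]; ring_nf
        have h2 : ‖v‖ₑ ^ ε ≠ 0 := by simp [ENNReal.rpow_eq_zero_iff, hve]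
        have h3 : ‖v‖ₑ ^ ε ≠ ∞ := ENNReal.rpow_ne_top_of_nonneg hε.le (by simp)
        rw [h1, div_eq_mul_inv, div_eq_mul_inv, div_eq_mul_inv, ENNReal.mul_inv (Or.inr h3)
          (Or.inr h2), ENNReal.mul_inv (Or.inl h2) (Or.inl h3)]
        ring
      · simp
    have hm : Measurable fun v : E =>
        (if ‖z - a‖ / (2 * L) < ‖v‖ then (‖v‖ₑ ^ (d + (τ + ε)))⁻¹ else 0) :=
      Measurable.ite (measurableSet_lt (by fun_prop) (by fun_prop)) (by fun_prop) measurable_const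
    simp only [hpt]
    rw [lintegral_const_mul _ hm]
    refine (mul_le_mul' le_rfl (hC (τ + ε) (by linarith) _ (by positivity))).trans (le_of_eq ?_)
    have hL2 : ENNReal.ofReal (2 * L) ≠ 0 := by simpa using hL
    have hα : 0 < τ + ε := by linarith
    have e0 : ENNReal.ofReal (2 * L) ^ (τ + ε) ≠ 0 :=
      (ENNReal.rpow_pos (pos_iff_ne_zero.2 hL2) ENNReal.ofReal_ne_top).ne'
    have e1 : ENNReal.ofReal (2 * L) ^ (τ + ε) ≠ ∞ :=
      ENNReal.rpow_ne_top_of_nonneg hα.le ENNReal.ofReal_ne_top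
    have h4 : ‖a - z‖ₑ ^ (d + τ) = ‖z - a‖ₑ ^ ((d : ℝ) - ε) * ‖z - a‖ₑ ^ (τ + ε) := by
      rw [enorm_sub_rev, ← ENNReal.rpow_add _ _ hwe0 (by simp)]; ring_nf
    have e2 : ‖z - a‖ₑ ^ (τ + ε) ≠ 0 := by simp [ENNReal.rpow_eq_zero_iff, hwe0]
    have e3 : ‖z - a‖ₑ ^ (τ + ε) ≠ ∞ := ENNReal.rpow_ne_top_of_nonneg hα.le (by simp)
    rw [ENNReal.ofReal_div_of_pos (by positivity), ofReal_norm,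
      ENNReal.div_rpow_of_nonneg _ _ hα.le, ENNReal.inv_div (Or.inl e1) (Or.inl e0), h4,
      div_eq_mul_inv, div_eq_mul_inv, div_eq_mul_inv, ENNReal.mul_inv (Or.inr e3) (Or.inr e2)]
    ring
  calc ∫⁻ v, ∫⁻ a, localEnergy μ D L ε p v a / ‖v‖ₑ ^ (d + τ) ∂μ ∂μ
      = ∫⁻ v, ∫⁻ a, ∫⁻ z, K ((v, a), z) / ‖v‖ₑ ^ (d + τ) ∂μ ∂μ ∂μ := by
        refine lintegral_congr fun v => lintegral_congr fun a => ?_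
        simp only [div_eq_mul_inv]
        rw [lintegral_mul_const _ (by fun_prop)]
        rfl
    _ = ∫⁻ a, ∫⁻ v, ∫⁻ z, K ((v, a), z) / ‖v‖ₑ ^ (d + τ) ∂μ ∂μ ∂μ :=
        lintegral_lintegral_swap (f := fun v a => ∫⁻ z, K ((v, a), z) / ‖v‖ₑ ^ (d + τ) ∂μ)
          (hmF.lintegral_prod_right' (ν := μ)).aemeasurable
    _ = ∫⁻ a, ∫⁻ z, ∫⁻ v, K ((v, a), z) / ‖v‖ₑ ^ (d + τ) ∂μ ∂μ ∂μ := by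
        refine lintegral_congr fun a => lintegral_lintegral_swap
          (f := fun v z => K ((v, a), z) / ‖v‖ₑ ^ (d + τ)) ?_
        exact (hmF.comp (by fun_prop : Measurable fun w : E × E => ((w.1, a), w.2))).aemeasurable
    _ ≤ ∫⁻ a, ∫⁻ z, C * ENNReal.ofReal (2 * L) ^ (τ + ε) *
        (D a z ^ p / ‖a - z‖ₑ ^ (d + τ)) ∂μ ∂μ := by
        gcongr; exact hinner _ _
    _ = _ := by
        have h1 : Measurable fun w : E × E => D w.1 w.2 ^ p / ‖w.1 - w.2‖ₑ ^ (d + τ) := by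
          have : Measurable fun w : E × E => D w.1 w.2 := hD
          fun_prop
        rw [← lintegral_const_mul _ h1.lintegral_prod_right']
        refine lintegral_congr fun a => ?_
        rw [lintegral_const_mul]
        exact h1.comp (by fun_prop : Measurable fun z : E => (a, z))

variable (μ)

/-- The pointwise majorant of the increments of the maximal function of `f`, in terms of the
increments `D` of `f`. -/
noncomputable def pairBound (D : E → E → ℝ≥0∞) (L ε p s : ℝ) (x y : E) : ℝ≥0∞ :=
  D x y + (2 * ‖x - y‖ₑ) ^ (Module.finrank ℝ E / p + s) *
      hlMax μ (fun z => D y z / ‖z - y‖ₑ ^ (Module.finrank ℝ E / p + s)) x +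
    (2 ^ Module.finrank ℝ E / μ (ball 0 1)) ^ (1 / p) *
      (localEnergy μ D L ε p (x - y) y ^ (1 / p) +
        hlMax μ (fun a => localEnergy μ D L ε p (x - y) a ^ (1 / p)) x +
        hlMax μ (fun a => localEnergy μ D L ε p (x - y) a ^ (1 / p)) y)

theorem measurable_hlMax_uncurry_div {D : E → E → ℝ≥0∞} (hD : Measurable (Function.uncurry D))
    (β : ℝ) : Measurable fun w : E × E => hlMax μ (fun z => D w.2 z / ‖z - w.2‖ₑ ^ β) w.1 := by
  have h1 : Measurable fun w : E × E => D w.1 w.2 := hD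
  have hk : Measurable (Function.uncurry fun y z : E => D y z / ‖z - y‖ₑ ^ β) :=
    h1.div (by fun_prop)
  have h' : Measurable fun w : E × E => (w.2, w.1) := by fun_prop
  simpa only [Function.comp_def] using (measurable_hlMax_uncurry μ hk).comp h'

theorem measurable_hlMax_localEnergy {D : E → E → ℝ≥0∞} (hD : Measurable (Function.uncurry D))
    (L ε p : ℝ) : Measurable fun w : E × E =>
      hlMax μ (fun a => localEnergy μ D L ε p w.1 a ^ (1 / p)) w.2 := by
  have hk : Measurable (Function.uncurry fun v a : E => localEnergy μ D L ε p v a ^ (1 / p)) :=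
    (measurable_localEnergy hD L ε p).pow_const _
  exact measurable_hlMax_uncurry μ hk

theorem measurable_pairBound {D : E → E → ℝ≥0∞} (hD : Measurable (Function.uncurry D))
    (L ε p s : ℝ) : Measurable fun w : E × E => pairBound μ D L ε p s w.1 w.2 := by
  have h1 : Measurable fun w : E × E => D w.1 w.2 := hD
  have h2 := (measurable_hlMax_uncurry_div μ hD (Module.finrank ℝ E / p + s))
  have h3 : Measurable fun w : E × E => localEnergy μ D L ε p w.1 w.2 :=
    measurable_localEnergy hD L ε p
  have h4 := measurable_hlMax_localEnergy μ hD L ε p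
  have h5 := h3.comp (by fun_prop : Measurable fun w : E × E => (w.1 - w.2, w.2))
  have h6 := h4.comp (by fun_prop : Measurable fun w : E × E => (w.1 - w.2, w.2))
  have h7 := h4.comp (by fun_prop : Measurable fun w : E × E => (w.1 - w.2, w.1))
  simp only [Function.comp_def] at h5 h6 h7
  have h8 : Measurable fun w : E × E =>
      (2 * ‖w.1 - w.2‖ₑ) ^ (Module.finrank ℝ E / p + s) := by fun_prop
  unfold pairBound
  exact (h1.add (h8.mul h2)).add (((((h5.pow_const _)).add h7).add h6).const_mul _)

set_option maxHeartbeats 400000 in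
theorem exists_lintegral_pairBound_le {p ε : ℝ} (hp : 1 < p) (hε : 0 < ε) (hε1 : ε < 1) :
    ∃ C : ℝ≥0, ∀ s : ℝ, 0 < s → s < 1 → ∀ L : ℝ, 1 ≤ L →
      ∀ D : E → E → ℝ≥0∞, (∀ a, D a a = 0) →
        Measurable (Function.uncurry D) →
      ∫⁻ x, ∫⁻ y, pairBound μ D L ε p s x y ^ p / ‖x - y‖ₑ ^ (Module.finrank ℝ E + s * p) ∂μ ∂μ ≤
        C * ENNReal.ofReal L ^ (s * p + ε) *
          ∫⁻ x, ∫⁻ y, D x y ^ p / ‖x - y‖ₑ ^ (Module.finrank ℝ E + s * p) ∂μ ∂μ := by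
  have hp0 : 0 < p := by linarith
  set d := Module.finrank ℝ E with hd
  obtain ⟨C₁, hC₁⟩ := lintegral_hlMax_rpow_le μ hp
  obtain ⟨C₂, hC₂⟩ := exists_lintegral_tail_le μ hε
  set c := (2 ^ d / μ (ball (0 : E) 1)) ^ (1 / p) with hc
  have hcT : c ≠ ∞ := ENNReal.rpow_ne_top_of_nonneg (by positivity)
    (ENNReal.div_ne_top (by finiteness) (measure_ball_pos μ 0 one_pos).ne')
  have hcpT : c ^ p ≠ ∞ := ENNReal.rpow_ne_top_of_nonneg hp0.le hcT
  -- The factors `4 ^ p` come from powers of three-term sums. The terms `2 ^ (d + p)` and `2 ^ (p +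
  -- 1)` dominate `2 ^ (d + s p)` and `2 ^ (s p + ε)`, so that `C` does not depend on `s`.
  set C : ℝ≥0∞ := 4 ^ p * (1 + 2 ^ (d + p) * C₁ +
    c ^ p * 4 ^ p * (1 + C₁ + C₁) * (C₂ * 2 ^ (p + 1))) with hC
  have hCT : C ≠ ∞ := by
    have h1 : (4 : ℝ≥0∞) ^ p ≠ ∞ := ENNReal.rpow_ne_top_of_nonneg hp0.le (by simp)
    have h2 : (2 : ℝ≥0∞) ^ (d + p) ≠ ∞ := ENNReal.rpow_ne_top_of_nonneg (by positivity) (by simp)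
    have h3 : (2 : ℝ≥0∞) ^ (p + 1) ≠ ∞ := ENNReal.rpow_ne_top_of_nonneg (by positivity) (by simp)
    finiteness
  refine ⟨C.toNNReal, fun s hs0 hs1 L hL D hDd hD => ?_⟩
  rw [ENNReal.coe_toNNReal hCT]
  have hsp : 0 < s * p := by positivity
  have hspp : s * p ≤ p := by nlinarith
  set γ : ℝ := d + s * p with hγ
  have hγ0 : 0 < γ := by positivity
  set β : ℝ := d / p + s with hβ
  have hβp : β * p = γ := by rw [hβ, hγ]; field_simp
  set N := ∫⁻ x, ∫⁻ y, D x y ^ p / ‖x - y‖ₑ ^ γ ∂μ ∂μ with hN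
  set J := ∫⁻ v, ∫⁻ a, localEnergy μ D L ε p v a / ‖v‖ₑ ^ γ ∂μ ∂μ with hJ
  set Λ := ENNReal.ofReal L ^ (s * p + ε) with hΛ
  have hΛ1 : 1 ≤ Λ := ENNReal.one_le_rpow (by simpa using hL) (by linarith)
  have hJN : J ≤ C₂ * 2 ^ (p + 1) * Λ * N := by
    refine (lintegral_lintegral_localEnergy_div_le hC₂ hε hDd hD hp0 hsp.le
      (by linarith)).trans ?_
    rw [ENNReal.ofReal_mul (by norm_num), ENNReal.mul_rpow_of_nonneg _ _ (by linarith),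
      ENNReal.ofReal_ofNat, ← mul_assoc]
    gcongr
    · norm_num
  set M₂ : E × E → ℝ≥0∞ := fun w => hlMax μ (fun z => D w.2 z / ‖z - w.2‖ₑ ^ β) w.1 with hM₂
  set M : E × E → ℝ≥0∞ := fun w => hlMax μ (fun a => localEnergy μ D L ε p w.1 a ^ (1 / p)) w.2
    with hM
  have hQm : Measurable fun w : E × E => localEnergy μ D L ε p w.1 w.2 :=
    measurable_localEnergy hD L ε p
  have hMm : Measurable M := measurable_hlMax_localEnergy μ hD L ε p
  have hM₂m : Measurable M₂ := measurable_hlMax_uncurry_div μ hD β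
  have hDm : Measurable fun w : E × E => D w.1 w.2 := hD
  have hWm : Measurable fun v : E => ‖v‖ₑ ^ γ := by fun_prop
  let F₁ : E × E → ℝ≥0∞ := fun w => D w.1 w.2 ^ p / ‖w.1 - w.2‖ₑ ^ γ
  let F₂ : E × E → ℝ≥0∞ := fun w => M₂ w ^ p
  let F₃ : E × E → ℝ≥0∞ := fun w => localEnergy μ D L ε p (w.1 - w.2) w.2 / ‖w.1 - w.2‖ₑ ^ γ
  let F₄ : E × E → ℝ≥0∞ := fun w => M (w.1 - w.2, w.1) ^ p / ‖w.1 - w.2‖ₑ ^ γ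
  let F₅ : E × E → ℝ≥0∞ := fun w => M (w.1 - w.2, w.2) ^ p / ‖w.1 - w.2‖ₑ ^ γ
  have hmap2 : Measurable fun w : E × E => (w.1 - w.2, w.2) := by fun_prop
  have hmap1 : Measurable fun w : E × E => (w.1 - w.2, w.1) := by fun_prop
  have hG₃ : Measurable fun w : E × E => localEnergy μ D L ε p w.1 w.2 / ‖w.1‖ₑ ^ γ := by fun_prop
  have hG₄ : Measurable fun w : E × E => M w ^ p / ‖w.1‖ₑ ^ γ := by fun_prop
  have hF₁ : Measurable F₁ := by fun_prop
  have hF₂ : Measurable F₂ := hM₂m.pow_const p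
  have hF₃ : Measurable F₃ := hG₃.comp hmap2
  have hF₄ : Measurable F₄ := hG₄.comp hmap1
  have hF₅ : Measurable F₅ := hG₄.comp hmap2
  have hI₁ : ∫⁻ w, F₁ w ∂(μ.prod μ) = N := lintegral_prod _ hF₁.aemeasurable
  have hI₂ : ∫⁻ w, F₂ w ∂(μ.prod μ) ≤ C₁ * N := by
    rw [lintegral_prod _ hF₂.aemeasurable,
      lintegral_lintegral_swap (f := fun x y => F₂ (x, y)) hF₂.aemeasurable]
    have hk : Measurable (Function.uncurry fun y z : E => D y z / ‖z - y‖ₑ ^ β) :=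
      hDm.div (by fun_prop)
    have h := lintegral_lintegral_hlMax_rpow_div_le (μ := μ) (p := p) hC₁ hk (w := fun _ => 1)
      measurable_const
    simp only [div_one] at h
    refine h.trans (le_of_eq ?_)
    congr 1
    refine lintegral_congr fun y => lintegral_congr fun z => ?_
    rw [ENNReal.div_rpow_of_nonneg _ _ hp0.le, ← ENNReal.rpow_mul, hβp, enorm_sub_rev]
  have hI₃ : ∫⁻ w, F₃ w ∂(μ.prod μ) = J := by
    rw [lintegral_prod _ hF₃.aemeasurable]
    exact lintegral_lintegral_sub_right hG₃
  have hMJ : ∫⁻ v, ∫⁻ a, M (v, a) ^ p / ‖v‖ₑ ^ γ ∂μ ∂μ ≤ C₁ * J := by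
    have hk : Measurable (Function.uncurry fun v a : E =>
        localEnergy μ D L ε p v a ^ (1 / p)) := hQm.pow_const _
    refine (lintegral_lintegral_hlMax_rpow_div_le hC₁ hk hWm).trans (le_of_eq ?_)
    congr 1
    refine lintegral_congr fun v => lintegral_congr fun a => ?_
    rw [← ENNReal.rpow_mul, one_div_mul_cancel hp0.ne', ENNReal.rpow_one]
  have hI₄ : ∫⁻ w, F₄ w ∂(μ.prod μ) ≤ C₁ * J := by
    rw [lintegral_prod _ hF₄.aemeasurable]
    exact (lintegral_lintegral_sub_left hG₄).trans_le hMJ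
  have hI₅ : ∫⁻ w, F₅ w ∂(μ.prod μ) ≤ C₁ * J := by
    rw [lintegral_prod _ hF₅.aemeasurable]
    exact (lintegral_lintegral_sub_right hG₄).trans_le hMJ
  have hpt : ∀ x y, pairBound μ D L ε p s x y ^ p / ‖x - y‖ₑ ^ γ ≤
      4 ^ p * (F₁ (x, y) + 2 ^ γ * F₂ (x, y) +
        c ^ p * 4 ^ p * (F₃ (x, y) + F₄ (x, y) + F₅ (x, y))) := by
    intro x y
    set W := ‖x - y‖ₑ ^ γ with hW
    have e1 : ((2 * ‖x - y‖ₑ) ^ β * M₂ (x, y)) ^ p / W ≤ 2 ^ γ * F₂ (x, y) := by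
      refine ENNReal.div_le_of_le_mul (le_of_eq ?_)
      rw [ENNReal.mul_rpow_of_nonneg _ _ hp0.le, ← ENNReal.rpow_mul, hβp,
        ENNReal.mul_rpow_of_nonneg _ _ hγ0.le]
      ring
    have e2 : (c * (localEnergy μ D L ε p (x - y) y ^ (1 / p) + M (x - y, x) +
        M (x - y, y))) ^ p / W ≤ c ^ p * 4 ^ p * (F₃ (x, y) + F₄ (x, y) + F₅ (x, y)) := by
      rw [ENNReal.mul_rpow_of_nonneg _ _ hp0.le]
      calc _ ≤ c ^ p * (4 ^ p * ((localEnergy μ D L ε p (x - y) y ^ (1 / p)) ^ p +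
            M (x - y, x) ^ p + M (x - y, y) ^ p)) / W := by
            refine ENNReal.div_le_div (mul_le_mul' le_rfl ?_) le_rfl
            exact ENNReal.rpow_add_add_le_four_rpow_mul hp.le _ _ _
        _ = _ := by
            have hq : (localEnergy μ D L ε p (x - y) y ^ (1 / p)) ^ p =
                localEnergy μ D L ε p (x - y) y := by
              rw [← ENNReal.rpow_mul, one_div_mul_cancel hp0.ne', ENNReal.rpow_one]
            rw [hq]
            simp only [F₃, F₄, F₅, div_eq_mul_inv, hW]
            ring
    calc pairBound μ D L ε p s x y ^ p / W
        ≤ 4 ^ p * (D x y ^ p + ((2 * ‖x - y‖ₑ) ^ β * M₂ (x, y)) ^ p +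
          (c * (localEnergy μ D L ε p (x - y) y ^ (1 / p) + M (x - y, x) +
            M (x - y, y))) ^ p) / W :=
          ENNReal.div_le_div (ENNReal.rpow_add_add_le_four_rpow_mul hp.le _ _ _) le_rfl
      _ = 4 ^ p * (D x y ^ p / W + ((2 * ‖x - y‖ₑ) ^ β * M₂ (x, y)) ^ p / W +
          (c * (localEnergy μ D L ε p (x - y) y ^ (1 / p) + M (x - y, x) +
            M (x - y, y))) ^ p / W) := by
          simp only [div_eq_mul_inv]; ring
      _ ≤ _ := by gcongr
  have h2γ : (2 : ℝ≥0∞) ^ γ ≤ 2 ^ (d + p) :=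
    ENNReal.rpow_le_rpow_of_exponent_le (by norm_num) (by rw [hγ]; linarith)
  calc ∫⁻ x, ∫⁻ y, pairBound μ D L ε p s x y ^ p / ‖x - y‖ₑ ^ γ ∂μ ∂μ
      ≤ ∫⁻ x, ∫⁻ y, 4 ^ p * (F₁ (x, y) + 2 ^ γ * F₂ (x, y) +
        c ^ p * 4 ^ p * (F₃ (x, y) + F₄ (x, y) + F₅ (x, y))) ∂μ ∂μ := by
        gcongr; exact hpt _ _
    _ = ∫⁻ w, 4 ^ p * (F₁ w + 2 ^ γ * F₂ w + c ^ p * 4 ^ p * (F₃ w + F₄ w + F₅ w)) ∂(μ.prod μ) := by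
        rw [lintegral_prod _ (by fun_prop)]
    _ = 4 ^ p * (∫⁻ w, F₁ w ∂(μ.prod μ) + 2 ^ γ * ∫⁻ w, F₂ w ∂(μ.prod μ) +
        c ^ p * 4 ^ p * (∫⁻ w, F₃ w ∂(μ.prod μ) + ∫⁻ w, F₄ w ∂(μ.prod μ) +
          ∫⁻ w, F₅ w ∂(μ.prod μ))) := by
        rw [lintegral_const_mul _ (by fun_prop), lintegral_add_right _ (by fun_prop),
          lintegral_add_right _ (by fun_prop), lintegral_const_mul _ (by fun_prop),
          lintegral_const_mul _ (by fun_prop), lintegral_add_right _ (by fun_prop),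
          lintegral_add_right _ (by fun_prop)]
    _ ≤ 4 ^ p * (Λ * N + 2 ^ (d + p) * (C₁ * (Λ * N)) +
        c ^ p * 4 ^ p * (C₂ * 2 ^ (p + 1) * Λ * N + C₁ * (C₂ * 2 ^ (p + 1) * Λ * N) +
          C₁ * (C₂ * 2 ^ (p + 1) * Λ * N))) := by
        -- The increment and small-radius terms carry no power of `L`; `Λ ≥ 1` brings them to the
        -- common form.
        have hNΛ : N ≤ Λ * N := le_mul_of_one_le_left' hΛ1
        rw [hI₁, hI₃]
        gcongr
        · exact hI₂.trans (mul_le_mul' le_rfl hNΛ)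
        · exact hI₄.trans (mul_le_mul' le_rfl hJN)
        · exact hI₅.trans (mul_le_mul' le_rfl hJN)
    _ = _ := by rw [hC]; ring

end EnergyIntegrals

/-! ### The operator `maximalR`: pointwise estimate, measurability, finiteness and seminorm bound.
-/

section LocalMaximal

/-- The ball is connected, meets `G` and misses its frontier, so it cannot reach the complement of
the closure. -/
theorem ball_subset_of_ofReal_le_infEDist {E : Type*} [NormedAddCommGroup E] [NormedSpace ℝ E]
    {G : Set E} (hG : IsOpen G) {x : E} (hx : x ∈ G) {r : ℝ}
    (hr : ENNReal.ofReal r ≤ infEDist x (frontier G)) : ball x r ⊆ G := by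
  rcases le_or_gt r 0 with h0 | h0
  · simp [ball_eq_empty.2 h0]
  refine (convex_ball x r).isPreconnected.subset_left_of_subset_union hG
    isClosed_closure.isOpen_compl (disjoint_compl_right.mono_left subset_closure) ?_
    ⟨x, mem_ball_self h0, hx⟩
  intro z hz
  by_contra hcon
  simp only [mem_union, mem_compl_iff, not_or, not_not] at hcon
  have hzf : z ∈ frontier G := ⟨hcon.2, by rw [hG.interior_eq]; exact hcon.1⟩
  have h1 : infEDist x (frontier G) ≤ edist x z := infEDist_le_edist_of_mem hzf
  have h2 : edist x z < ENNReal.ofReal r := by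
    rw [edist_comm, edist_dist]
    exact (ENNReal.ofReal_lt_ofReal_iff h0).2 hz
  exact absurd (hr.trans h1) (not_le.2 h2)

/-- Only the error attached to the larger of `a`, `b` is needed; the sum covers both orders. -/
theorem enorm_toReal_sub_rpow_le {a b k k' : ℝ≥0∞} (ha : a ≠ ∞) (hb : b ≠ ∞) (h : a ≤ b + k)
    (h' : b ≤ a + k') {p : ℝ} (hp : 0 ≤ p) : ‖a.toReal - b.toReal‖ₑ ^ p ≤ k ^ p + k' ^ p := by
  have key : ∀ {a b k : ℝ≥0∞}, a ≠ ∞ → a ≤ b + k → b ≤ a → ‖a.toReal - b.toReal‖ₑ ≤ k := by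
    intro a b k ha h hba
    rw [← ENNReal.toReal_sub_of_le hba ha, Real.enorm_eq_ofReal ENNReal.toReal_nonneg,
      ENNReal.ofReal_toReal (ENNReal.sub_ne_top ha)]
    exact tsub_le_iff_left.2 h
  rcases le_total b a with hba | hab
  · exact (ENNReal.rpow_le_rpow (key ha h hba) hp).trans le_self_add
  · rw [enorm_sub_rev]
    exact (ENNReal.rpow_le_rpow (key hb h' hab) hp).trans le_add_self

theorem lintegral_lintegral_add_swap {α : Type*} [MeasurableSpace α] {μ : Measure α} [SFinite μ]
    {F : α → α → ℝ≥0∞} (hF : Measurable (Function.uncurry F)) :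
    ∫⁻ x, ∫⁻ y, (F x y + F y x) ∂μ ∂μ = 2 * ∫⁻ x, ∫⁻ y, F x y ∂μ ∂μ := by
  have h : ∀ x, ∫⁻ y, (F x y + F y x) ∂μ = ∫⁻ y, F x y ∂μ + ∫⁻ y, F y x ∂μ := fun x =>
    lintegral_add_left hF.of_uncurry_left _
  have hm : Measurable fun x => ∫⁻ y, F x y ∂μ := hF.lintegral_prod_right'
  simp only [h]
  rw [lintegral_add_left hm, ← lintegral_lintegral_swap hF.aemeasurable, two_mul]

variable {n : ℕ} {G : Set (EuclideanSpace ℝ (Fin n))} {f R : EuclideanSpace ℝ (Fin n) → ℝ}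

theorem ballMean_le_maximalR {x : EuclideanSpace ℝ (Fin n)} {r : ℝ} (h0 : 0 ≤ r) (hr : r ≤ R x) :
    ballMean f x r ≤ maximalR R f x :=
  le_iSup₂ (f := fun (r : ℝ) (_ : r ∈ Icc (0 : ℝ) (R x)) => ballMean f x r) r ⟨h0, hr⟩

theorem maximalR_le_add_pairBound (hG : IsOpen G) (hf : Measurable f) {L : ℝ≥0} (hL : 1 ≤ L)
    (hRL : LipschitzOnWith L R G)
    (hR : ∀ x ∈ G, 0 ≤ R x ∧ ENNReal.ofReal (R x) ≤ infEDist x (frontier G))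
    {p ε s : ℝ} (hp : 1 ≤ p) (hε : 0 < ε) (hεn : ε ≤ n) (hs : 0 ≤ s)
    {x y : EuclideanSpace ℝ (Fin n)} (hx : x ∈ G) (hy : y ∈ G) (hxy : x ≠ y) :
    maximalR R f x ≤ maximalR R f y + pairBound volume (localDiff G f) L ε p s x y := by
  have hεd : ε ≤ Module.finrank ℝ (EuclideanSpace ℝ (Fin n)) := by simpa using hεn
  have hh : 0 < ‖x - y‖ := norm_pos_iff.2 (sub_ne_zero.2 hxy)
  have hball : ∀ z ∈ G, ∀ r, r ≤ R z → ball z r ⊆ G := fun z hz r hr =>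
    ball_subset_of_ofReal_le_infEDist hG hz ((ENNReal.ofReal_le_ofReal hr).trans (hR z hz).2)
  have hfy : ‖f y‖ₑ ≤ maximalR R f y := by
    simpa [ballMean] using ballMean_le_maximalR (f := f) le_rfl (hR y hy).1
  refine iSup₂_le fun r hr => ?_
  rcases hr.1.eq_or_lt with h0 | h0
  · subst h0
    simp only [ballMean, if_true]
    refine (enorm_le_add_localDiff hx hy).trans (add_le_add hfy ?_)
    rw [localDiff_comm, pairBound, add_assoc]
    exact le_self_add
  rw [ballMean, if_neg h0.ne']
  have hsub := hball x hx r hr.2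
  rcases le_or_gt r ‖x - y‖ with h1 | h1
  · refine (setLAverage_le_of_radius_le_dist (β := Module.finrank ℝ (EuclideanSpace ℝ (Fin n)) / p + s)
      h0 h1 hsub hy (by positivity)).trans
      (add_le_add hfy ?_)
    rw [pairBound]
    exact le_add_self.trans le_self_add
  rcases le_or_gt r (L * ‖x - y‖) with h2 | h2
  · refine (setLAverage_le_of_radius_le_mul_dist hG.measurableSet hf hp hε hεd hh h1.le h2 hsub
      hy).trans (add_le_add hfy ?_)
    rw [pairBound]
    refine le_trans ?_ le_add_self
    gcongr
    rw [add_assoc]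
    exact le_self_add
  -- The Lipschitz condition on `R` makes the shrunken radius admissible at `y`.
  · have hRy : r - L * ‖x - y‖ ≤ R y := by
      have h3 := hRL.dist_le_mul x hx y hy
      rw [dist_eq_norm x y, Real.dist_eq] at h3
      have h4 := (le_abs_self _).trans h3
      linarith [hr.2]
    refine (setLAverage_le_of_mul_dist_lt_radius (ε := ε) hG.measurableSet hf hL hp hε hεd hh h2
      hsub (hball y hy _ hRy)).trans (add_le_add ?_ ?_)
    · have h3 := ballMean_le_maximalR (f := f) (x := y) (by linarith) hRy
      rwa [ballMean, if_neg (by linarith)] at h3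
    · rw [pairBound]
      refine le_trans ?_ le_add_self
      rw [add_assoc]
      exact mul_le_mul' le_rfl le_add_self

theorem maximalR_eq_iSup_rat {x : EuclideanSpace ℝ (Fin n)} (hx : 0 ≤ R x) :
    maximalR R f x = ‖f x‖ₑ ⊔ ⨆ (q : ℚ) (_ : 0 < q),
      if (q : ℝ) < R x then (⨍⁻ y in ball x q, ‖f y‖ₑ ∂volume) else 0 := by
  refine le_antisymm (iSup₂_le fun r hr => ?_) (sup_le ?_ (iSup₂_le fun q hq => ?_))
  · rcases hr.1.eq_or_lt with h0 | h0
    · subst h0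
      simp only [ballMean, if_true]
      exact le_sup_left
    · rw [ballMean, if_neg h0.ne']
      refine (setLAverage_ball_le_iSup volume _ x r).trans (le_trans ?_ le_sup_right)
      refine iSup_mono fun q => iSup_le fun hq => ?_
      refine le_trans (le_of_eq ?_) (le_iSup _ hq.1)
      rw [if_pos (hq.2.trans_le hr.2)]
  · simpa [ballMean] using ballMean_le_maximalR (f := f) le_rfl hx
  · split_ifs with h
    · have hq0 : (0 : ℝ) < q := by exact_mod_cast hq
      have h1 := ballMean_le_maximalR (f := f) hq0.le h.le
      rwa [ballMean, if_neg hq0.ne'] at h1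
    · exact zero_le

theorem measurable_maximalR (hf : Measurable f) (hR : Measurable R) (hR0 : ∀ x, 0 ≤ R x) :
    Measurable (maximalR R f) := by
  have h : maximalR R f = fun x => ‖f x‖ₑ ⊔ ⨆ (q : ℚ) (_ : 0 < q),
      if (q : ℝ) < R x then (⨍⁻ y in ball x q, ‖f y‖ₑ ∂volume) else 0 :=
    funext fun x => maximalR_eq_iSup_rat (hR0 x)
  rw [h]
  refine hf.enorm.max (.iSup fun q => .iSup fun _ => ?_)
  refine Measurable.ite (measurableSet_lt measurable_const hR) ?_ measurable_const
  have hk : Measurable (Function.uncurry fun (_ : Unit) (y : EuclideanSpace ℝ (Fin n)) =>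
    ‖f y‖ₑ) := hf.enorm.comp measurable_snd
  have h' : Measurable fun x : EuclideanSpace ℝ (Fin n) => ((), x) := by fun_prop
  simpa only [Function.comp_def] using
    (measurable_setLAverage_ball volume hk (ρ := fun _ => (q : ℝ)) measurable_const).comp h'

/-- Positive radii ignore null sets as long as the balls stay in `G`; the radius `0` sees the value
at `x` itself, hence the hypothesis `f x = g x`. -/
theorem maximalR_congr {g R' : EuclideanSpace ℝ (Fin n) → ℝ}
    {x : EuclideanSpace ℝ (Fin n)} (hG : MeasurableSet G)
    (hball : ∀ r ≤ R x, ball x r ⊆ G) (hfg : f =ᵐ[volume.restrict G] g) (hx : f x = g x)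
    (hRR : R x = R' x) : maximalR R f x = maximalR R' g x := by
  unfold maximalR
  rw [hRR]
  refine iSup_congr fun r => iSup_congr fun hr => ?_
  unfold ballMean
  split_ifs with h0
  · rw [hx]
  · refine setLAverage_congr_fun_ae measurableSet_ball ?_
    filter_upwards [(ae_restrict_iff' hG).1 hfg] with y hy hyb
    rw [hy (hball r (hRR ▸ hr.2) hyb)]

theorem maximalR_le_max_hlMax (hball : ∀ x ∈ G, ∀ r ≤ R x, ball x r ⊆ G)
    {x : EuclideanSpace ℝ (Fin n)} (hx : x ∈ G) :
    maximalR R f x ≤ ‖f x‖ₑ ⊔ hlMax volume (G.indicator fun y => ‖f y‖ₑ) x := by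
  refine iSup₂_le fun r hr => ?_
  rcases hr.1.eq_or_lt with h0 | h0
  · subst h0
    simp only [ballMean, if_true]
    exact le_sup_left
  · rw [ballMean, if_neg h0.ne']
    refine le_trans (le_of_eq ?_) ((setLAverage_ball_le_hlMax volume _ x r).trans le_sup_right)
    refine setLAverage_congr_fun measurableSet_ball fun y hy => ?_
    rw [indicator_of_mem (hball x hx r hr.2 hy)]

theorem ae_maximalR_lt_top {p : ℝ} (hp : 1 < p) (hG : MeasurableSet G)
    (hball : ∀ x ∈ G, ∀ r ≤ R x, ball x r ⊆ G) (hf : Measurable f)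
    (hfp : ∫⁻ x in G, ‖f x‖ₑ ^ p < ∞) :
    ∀ᵐ x ∂(volume.restrict G), maximalR R f x < ∞ := by
  have hp0 : 0 < p := by linarith
  obtain ⟨C, hC⟩ := lintegral_hlMax_rpow_le
    (volume : Measure (EuclideanSpace ℝ (Fin n))) hp
  have hm : Measurable (G.indicator fun y => ‖f y‖ₑ) := hf.enorm.indicator hG
  have hlt : ∫⁻ x, hlMax volume (G.indicator fun y => ‖f y‖ₑ) x ^ p < ∞ := by
    refine (hC _ hm).trans_lt (ENNReal.mul_lt_top ENNReal.coe_lt_top ?_)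
    refine lt_of_eq_of_lt ?_ hfp
    rw [← lintegral_indicator hG]
    refine lintegral_congr fun x => ?_
    by_cases hx : x ∈ G <;> simp [hx, hp0]
  have hae := ae_lt_top ((measurable_hlMax volume hm).pow_const p) hlt.ne
  filter_upwards [ae_restrict_of_ae hae, ae_restrict_mem hG] with x hx hxG
  refine (maximalR_le_max_hlMax hball hxG).trans_lt (max_lt enorm_lt_top ?_)
  exact (ENNReal.rpow_lt_top_iff_of_pos hp0).1 hx

theorem fracSobolevSeminorm_congr {s p : ℝ} {g : EuclideanSpace ℝ (Fin n) → ℝ}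
    (h : f =ᵐ[volume.restrict G] g) :
    fracSobolevSeminorm s p G f = fracSobolevSeminorm s p G g := by
  unfold fracSobolevSeminorm
  congr 1
  refine lintegral_congr_ae ?_
  filter_upwards [h] with x hx
  refine lintegral_congr_ae ?_
  filter_upwards [h] with y hy
  rw [hx, hy]

theorem lintegral_localDiff_rpow_div {p : ℝ} (hp : 0 < p) (hG : MeasurableSet G)
    (W : EuclideanSpace ℝ (Fin n) → ℝ≥0∞) :
    ∫⁻ x, ∫⁻ y, localDiff G f x y ^ p / W (x - y) =
      ∫⁻ x in G, ∫⁻ y in G, ‖f x - f y‖ₑ ^ p / W (x - y) := by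
  rw [← lintegral_indicator hG]
  refine lintegral_congr fun x => ?_
  by_cases hx : x ∈ G
  · rw [indicator_of_mem hx, ← lintegral_indicator hG]
    refine lintegral_congr fun y => ?_
    by_cases hy : y ∈ G <;> simp [localDiff, hx, hy, hp]
  · simp [localDiff, hx, hp]

/-- `pairBound` is not symmetric, so the increment is bounded by the sum over both orders of the
pair; exchanging the variables gives the factor `2`. -/
theorem fracSobolevSeminorm_maximalR_le {p ε : ℝ} {C : ℝ≥0} (hp : 1 < p) (hε : 0 < ε)
    (hεn : ε ≤ n) {s : ℝ} (hs : 0 < s) {L : ℝ≥0} (hL : 1 ≤ L)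
    (hC : ∀ D : EuclideanSpace ℝ (Fin n) → EuclideanSpace ℝ (Fin n) → ℝ≥0∞,
      (∀ a, D a a = 0) → Measurable (Function.uncurry D) →
      ∫⁻ x, ∫⁻ y, pairBound volume D L ε p s x y ^ p / ‖x - y‖ₑ ^ ((n : ℝ) + s * p) ≤
        C * (L : ℝ≥0∞) ^ (s * p + ε) *
          ∫⁻ x, ∫⁻ y, D x y ^ p / ‖x - y‖ₑ ^ ((n : ℝ) + s * p))
    (hG : IsOpen G) (hRL : LipschitzOnWith L R G)
    (hR : ∀ x ∈ G, 0 ≤ R x ∧ ENNReal.ofReal (R x) ≤ infEDist x (frontier G))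
    (hf : Measurable f) (hfin : ∀ᵐ x ∂(volume.restrict G), maximalR R f x < ∞) :
    fracSobolevSeminorm s p G (fun x => (maximalR R f x).toReal) ≤
      (2 * C) ^ (1 / p) * (L : ℝ≥0∞) ^ (ε / p + s) * fracSobolevSeminorm s p G f := by
  have hp0 : 0 < p := by linarith
  have hDm := measurable_localDiff hG.measurableSet hf
  set P := fun x y => pairBound volume (localDiff G f) L ε p s x y with hP
  set W := fun v : EuclideanSpace ℝ (Fin n) => ‖v‖ₑ ^ ((n : ℝ) + s * p) with hW
  have hPm : Measurable fun w : EuclideanSpace ℝ (Fin n) × EuclideanSpace ℝ (Fin n) =>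
      P w.1 w.2 ^ p / W (w.1 - w.2) := by
    have := measurable_pairBound volume hDm L ε p s
    simp only [hP, hW]
    fun_prop
  have hWs : ∀ x y, W (x - y) = W (y - x) := fun x y => by simp only [hW, enorm_sub_rev]
  have hpt : ∀ᵐ x ∂(volume.restrict G), ∀ᵐ y ∂(volume.restrict G),
      ‖(maximalR R f x).toReal - (maximalR R f y).toReal‖ₑ ^ p / W (x - y) ≤
        P x y ^ p / W (x - y) + P y x ^ p / W (y - x) := by
    filter_upwards [hfin, ae_restrict_mem hG.measurableSet] with x hx hxG
    filter_upwards [hfin, ae_restrict_mem hG.measurableSet] with y hy hyG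
    rcases eq_or_ne x y with rfl | hxy
    · simp [ENNReal.zero_rpow_of_pos hp0]
    rw [hWs y x, ← ENNReal.add_div]
    refine ENNReal.div_le_div (enorm_toReal_sub_rpow_le hx.ne hy.ne ?_ ?_ hp0.le) le_rfl
    · exact maximalR_le_add_pairBound hG hf hL hRL hR hp.le hε hεn hs.le hxG hyG hxy
    · exact maximalR_le_add_pairBound hG hf hL hRL hR hp.le hε hεn hs.le hyG hxG hxy.symm
  have hint : ∫⁻ x in G, ∫⁻ y in G,
      ‖(maximalR R f x).toReal - (maximalR R f y).toReal‖ₑ ^ p / W (x - y) ≤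
      2 * C * (L : ℝ≥0∞) ^ (s * p + ε) * ∫⁻ x in G, ∫⁻ y in G, ‖f x - f y‖ₑ ^ p / W (x - y) := by
    calc _ ≤ ∫⁻ x in G, ∫⁻ y in G, (P x y ^ p / W (x - y) + P y x ^ p / W (y - x)) := by
          refine lintegral_mono_ae ?_
          filter_upwards [hpt] with x hx
          exact lintegral_mono_ae hx
      _ ≤ ∫⁻ x, ∫⁻ y, (P x y ^ p / W (x - y) + P y x ^ p / W (y - x)) :=
          (setLIntegral_le_lintegral _ _).trans
            (lintegral_mono fun x => setLIntegral_le_lintegral _ _)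
      _ = 2 * ∫⁻ x, ∫⁻ y, P x y ^ p / W (x - y) :=
          lintegral_lintegral_add_swap (F := fun x y => P x y ^ p / W (x - y)) hPm
      _ ≤ 2 * (C * (L : ℝ≥0∞) ^ (s * p + ε) * ∫⁻ x, ∫⁻ y, localDiff G f x y ^ p / W (x - y)) :=
          mul_le_mul' le_rfl (hC _ localDiff_self hDm)
      _ = _ := by
          rw [lintegral_localDiff_rpow_div hp0 hG.measurableSet W]
          ring
  unfold fracSobolevSeminorm
  refine (ENNReal.rpow_le_rpow hint (by positivity)).trans (le_of_eq ?_)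
  rw [ENNReal.mul_rpow_of_nonneg _ _ (by positivity), ENNReal.mul_rpow_of_nonneg _ _ (by positivity),
    ← ENNReal.rpow_mul]
  congr 3
  field_simp
  ring

/-- Covers `n = 0`, where `ε ≤ n` fails. -/
theorem fracSobolevSeminorm_zero_dim {s p : ℝ} (hp : 0 < p) (hn : n = 0) :
    fracSobolevSeminorm s p G f = 0 := by
  subst hn
  have h : ∀ x y : EuclideanSpace ℝ (Fin 0),
      ‖f x - f y‖ₑ ^ p / ‖x - y‖ₑ ^ (((0 : ℕ) : ℝ) + s * p) = 0 := fun x y => by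
    rw [Subsingleton.elim x y]
    simp [hp]
  simp only [fracSobolevSeminorm, h]
  simp [hp]

theorem aemeasurable_maximalR (hG : IsOpen G) (hRc : ContinuousOn R G)
    (hR : ∀ x ∈ G, 0 ≤ R x ∧ ENNReal.ofReal (R x) ≤ infEDist x (frontier G))
    (hf : AEMeasurable f (volume.restrict G)) :
    AEMeasurable (maximalR R f) (volume.restrict G) := by
  classical
  -- Nothing is known about `R` off `G`, so it is set to `0` there, which makes it measurable and
  -- nonnegative everywhere.
  refine ⟨maximalR (G.piecewise R 0) (hf.mk f), measurable_maximalR hf.measurable_mk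
    (hRc.measurable_piecewise continuousOn_const hG.measurableSet) ?_, ?_⟩
  · intro x
    by_cases hx : x ∈ G
    · simpa [hx] using (hR x hx).1
    · simp [hx]
  · filter_upwards [hf.ae_eq_mk, ae_restrict_mem hG.measurableSet] with x hx hxG
    refine maximalR_congr hG.measurableSet (fun r hr => ?_) hf.ae_eq_mk hx (by simp [hxG])
    exact ball_subset_of_ofReal_le_infEDist hG hxG
      ((ENNReal.ofReal_le_ofReal hr).trans (hR x hxG).2)

end LocalMaximal

/-- The constant `C` depends on `n`, `p` and `ε` only. The first two parts of the conclusion say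
that `M_R f` is a measurable function on `G` that is finite almost everywhere, so that its
seminorm is meaningful (and `toReal` changes `M_R f` on a null set of `G` only). If `∂G = ∅`
then `infEDist x (frontier G) = ∞`. -/
theorem corollary5p4 (n : ℕ) (p ε : ℝ) (hp : 1 < p) (hε0 : 0 < ε) (hε1 : ε < 1) :
    ∃ C : ℝ≥0, 0 < C ∧
      ∀ (s : ℝ), 0 < s → s < 1 →
      ∀ (G : Set (EuclideanSpace ℝ (Fin n))), IsOpen G → G.Nonempty →
      ∀ (L : ℝ≥0) (R : EuclideanSpace ℝ (Fin n) → ℝ), LipschitzOnWith L R G →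
        (∀ x ∈ G, 0 ≤ R x ∧ ENNReal.ofReal (R x) ≤ infEDist x (frontier G)) →
      ∀ (f : EuclideanSpace ℝ (Fin n) → ℝ), MemLp f (ENNReal.ofReal p) (volume.restrict G) →
        AEMeasurable (maximalR R f) (volume.restrict G) ∧
        (∀ᵐ x ∂(volume.restrict G), maximalR R f x < ∞) ∧
        fracSobolevSeminorm s p G (fun x => (maximalR R f x).toReal) ≤
          (C : ℝ≥0∞) * (1 + (L : ℝ≥0∞)) ^ (ε / p + s) * fracSobolevSeminorm s p G f := by
  have hp0 : 0 < p := by linarith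
  obtain ⟨C, hC⟩ := exists_lintegral_pairBound_le
    (volume : Measure (EuclideanSpace ℝ (Fin n))) hp hε0 hε1
  -- The summand `1` only ensures that the constant is positive.
  refine ⟨(2 * C) ^ (1 / p) + 1, by positivity,
    fun s hs0 hs1 G hG _ L R hRL hR f hf => ?_⟩
  have hball : ∀ x ∈ G, ∀ r ≤ R x, ball x r ⊆ G := fun x hx r hr =>
    ball_subset_of_ofReal_le_infEDist hG hx ((ENNReal.ofReal_le_ofReal hr).trans (hR x hx).2)
  have hfm : AEMeasurable f (volume.restrict G) := hf.1.aemeasurable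
  set g := hfm.mk f with hg
  have hgm : Measurable g := hfm.measurable_mk
  have hfg : f =ᵐ[volume.restrict G] g := hfm.ae_eq_mk
  have hMfg : ∀ᵐ x ∂(volume.restrict G), maximalR R f x = maximalR R g x := by
    filter_upwards [hfg, ae_restrict_mem hG.measurableSet] with x hx hxG
    exact maximalR_congr hG.measurableSet (hball x hxG) hfg hx rfl
  have hgp : ∫⁻ x in G, ‖g x‖ₑ ^ p < ∞ := by
    have h := lintegral_rpow_enorm_lt_top_of_eLpNorm_lt_top (by simpa using hp0) (by simp)
      (hf.ae_eq hfg).2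
    rwa [ENNReal.toReal_ofReal hp0.le] at h
  have hfin := ae_maximalR_lt_top hp hG.measurableSet hball hgm hgp
  refine ⟨aemeasurable_maximalR hG hRL.continuousOn hR hfm, ?_, ?_⟩
  · filter_upwards [hMfg, hfin] with x h1 h2
    rwa [h1]
  rcases Nat.eq_zero_or_pos n with hn | hn
  · rw [fracSobolevSeminorm_zero_dim hp0 hn]
    exact zero_le
  have hεn : ε ≤ n := hε1.le.trans (by exact_mod_cast hn)
  -- The estimate needs a Lipschitz constant of at least `1`, and `max 1 L ≤ 1 + L`.
  have h := fracSobolevSeminorm_maximalR_le (s := s) (C := C) (L := max 1 L) hp hε0 hεn hs0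
    (le_max_left _ _) (fun D hDd hD => by
      have h := hC s hs0 hs1 (max 1 L : ℝ≥0) (by simp) D hDd hD
      rwa [ENNReal.ofReal_coe_nnreal, finrank_euclideanSpace_fin] at h) hG (hRL.weaken (le_max_right _ _)) hR hgm hfin
  rw [fracSobolevSeminorm_congr hfg, fracSobolevSeminorm_congr
    (g := fun x => (maximalR R g x).toReal) (hMfg.mono fun x hx => by simp only [hx])]
  refine h.trans ?_
  gcongr
  · rw [ENNReal.coe_add, ENNReal.coe_rpow_of_nonneg _ (by positivity), ENNReal.coe_mul]
    exact le_self_add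
  · rw [ENNReal.coe_max]
    exact max_le le_self_add le_add_self
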